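/- Let $k$ be a field of characteristic zero, $n \ge 0$, $R = k[x_1,\dots,x_n]$ and $\widehat R = k[[x_1,\dots,x_n]]$. Let $\mathscr D = \mathscr D(R,k)$ and $\widehat{\mathscr D} = \mathscr D(\widehat R,k)$ be the rings of $k$-linear differential operators on $R$ and on $\widehat R$; they are generated over $R$ (resp. $\widehat R$) by the partial derivatives $\partial_1,\dots,\partial_n$, and $\mathscr D\subseteq\widehat{\mathscr D}$. For a left $\mathscr D$-module $M$ let $\widehat M = \widehat R\otimes_R M$, a left $\widehat{\mathscr D}$-module by $\partial_i(s\otimes m)=\partial_i(s)\otimes m+s\otimes\partial_i m$, and let $\kappa: M\to\widehat M$, $\kappa(m)=1\otimes m$. For a left module $N$ over $\mathscr D$ or $\widehat{\mathscr D}$, let $\Omega^\bullet(N)$ be its de Rham complex: $\Omega^i(N)=\bigoplus_{j_1<\dots<j_i} N\,dx_{j_1}\wedge\dots\wedge dx_{j_i}$ with $d(m\,dx_{j_1}\wedge\dots\wedge dx_{j_i})=\sum_{s=1}^n \partial_s m\,dx_s\wedge dx_{j_1}\wedge\dots\wedge dx_{j_i}$, and let $H^i_{\mathrm{dR}}(N)$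 be its cohomology, a $k$-space. Let $\tau$ be the standard transposition, $\tau(f\partial^\alpha)=(-1)^{|\alpha|}\partial^\alpha f$, and let $R^\tau$ (resp. $\widehat R^\tau$) be the right $\mathscr D$-module $R$ (resp. right $\widehat{\mathscr D}$-module $\widehat R$) with action $r\cdot\delta=\tau(\delta)(r)$. The map $\kappa$ induces $\kappa^i: H^i_{\mathrm{dR}}(M)\to H^i_{\mathrm{dR}}(\widehat M)$ by applying $\kappa$ to every summand of $\Omega^\bullet(M)$, and, together with the inclusions $\mathscr D\subseteq\widehat{\mathscr D}$ and $R^\tau\subseteq\widehat R^\tau$, it induces $\iota_j:\operatorname{Tor}^{\mathscr D}_j(R^\tau,M)\to\operatorname{Tor}^{\widehat{\mathscr D}}_j(\widehat R^\tau,\widehat M)$. For every left $\mathscr D$-module $M$ and every $i$ with $0\le i\le n$ there is a commutative square of $k$-linear maps $$\begin{array}{ccc} H^i_{\mathrm{dR}}(M) & \longrightarrow & \operatorname{Tor}^{\mathscr D}_{n-i}(R^\tau,M)\\ {\scriptstyle\kappa^i}\big\downarrow & & \big\downarrow{\scriptstyle\iota_{n-i}}\\ H^i_{\mathrm{dR}}(\widehat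 M) & \longrightarrow & \operatorname{Tor}^{\widehat{\mathscr D}}_{n-i}(\widehat R^\tau,\widehat M)\end{array}$$ whose horizontal maps are isomorphisms. More precisely, the horizontal maps are the canonical ones: if $F_\bullet\to M$ is a free resolution, the upper one is induced by the two augmentations $$\Omega^\bullet(M)\longleftarrow \operatorname{Tot}\,\Omega^\bullet(F_\bullet)\longrightarrow R^\tau\otimes_{\mathscr D}F_\bullet ,$$ the first given by $F_0\to M$ and the second by $\Omega^n(F_j)\to R^\tau\otimes_{\mathscr D}F_j$, $m\,dx_1\wedge\dots\wedge dx_n\mapsto 1\otimes m$; the lower one is the analogous map for $\widehat M$ over $\widehat{\mathscr D}$. For $i>n$ the spaces $H^i_{\mathrm{dR}}(M)$ and $H^i_{\mathrm{dR}}(\widehat M)$ vanish, as do, by convention, the Tor spaces in negative degrees $n-i$. -/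

import Mathlib

open scoped TensorProduct
open MulOpposite

noncomputable section

universe u v w


/-! ### Rings of differential operators -/

/-- `IsDiffOpLT k A m P`: the `k`-linear endomorphism `P` of the commutative `k`-algebra `A` is a
differential operator of order `< m`. Order `< 0` means `P = 0`; order `< m + 1` means that every
commutator `[P, a]` with a multiplication operator has order `< m`. -/
def IsDiffOpLT (k : Type u) (A : Type v) [CommRing k] [CommRing A] [Algebra k A] :
    ℕ → Module.End k A → Prop
  | 0, P => P = 0
  | m + 1, P => ∀ a : A, IsDiffOpLT k A m (P * Algebra.lmul k A a - Algebra.lmul k A a * P)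

section DiffOp

variable {k : Type u} {A : Type v} [CommRing k] [CommRing A] [Algebra k A]

theorem IsDiffOpLT.zero (m : ℕ) : IsDiffOpLT k A m 0 := by
  induction m with
  | zero => rfl
  | succ m ih => intro a; simpa using ih

theorem IsDiffOpLT.add {m : ℕ} {P Q : Module.End k A} (hP : IsDiffOpLT k A m P)
    (hQ : IsDiffOpLT k A m Q) : IsDiffOpLT k A m (P + Q) := by
  induction m generalizing P Q with
  | zero => simp only [IsDiffOpLT] at *; simp [hP, hQ]
  | succ m ih =>
    intro a
    convert ih (hP a) (hQ a) using 1
    noncomm_ring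

theorem IsDiffOpLT.succ {m : ℕ} {P : Module.End k A} (hP : IsDiffOpLT k A m P) :
    IsDiffOpLT k A (m + 1) P := by
  induction m generalizing P with
  | zero => intro a; simp only [IsDiffOpLT] at *; simp [hP]
  | succ m ih => intro a; exact ih (hP a)

theorem IsDiffOpLT.mono {m l : ℕ} (h : m ≤ l) {P : Module.End k A} (hP : IsDiffOpLT k A m P) :
    IsDiffOpLT k A l P := by
  induction h with
  | refl => exact hP
  | step _ ih => exact ih.succ

theorem IsDiffOpLT.mul {p q : ℕ} {P Q : Module.End k A} (hP : IsDiffOpLT k A p P)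
    (hQ : IsDiffOpLT k A q Q) : IsDiffOpLT k A (p + q) (P * Q) := by
  induction p generalizing P q Q with
  | zero =>
    simp only [IsDiffOpLT] at hP
    simpa [hP] using IsDiffOpLT.zero _
  | succ p ihp =>
    induction q generalizing P Q with
    | zero =>
      simp only [IsDiffOpLT] at hQ
      simpa [hQ] using IsDiffOpLT.zero _
    | succ q ihq =>
      intro a
      have h1 := ihq hP (hQ a)
      have h2 := ihp (hP a) hQ
      have h2' := h2.mono (l := p + 1 + q) (by omega)
      have h3 := h1.add h2'
      have e : P * Q * Algebra.lmul k A a - Algebra.lmul k A a * (P * Q)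
          = P * (Q * Algebra.lmul k A a - Algebra.lmul k A a * Q)
            + (P * Algebra.lmul k A a - Algebra.lmul k A a * P) * Q := by
        rw [mul_sub, sub_mul]
        simp only [mul_assoc]
        abel
      rw [← e] at h3
      exact h3

theorem IsDiffOpLT.lmul (a : A) : IsDiffOpLT k A 1 (Algebra.lmul k A a) := by
  intro b
  show _ = _
  rw [← map_mul, ← map_mul, mul_comm, sub_self]

theorem IsDiffOpLT.lmul_mul {m : ℕ} {P : Module.End k A} (hP : IsDiffOpLT k A m P) (b : A) :
    IsDiffOpLT k A m (Algebra.lmul k A b * P) := by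
  induction m generalizing P with
  | zero => simp only [IsDiffOpLT] at *; simp [hP]
  | succ m ih =>
    intro a
    convert ih (hP a) using 1
    rw [mul_sub, ← mul_assoc, ← mul_assoc, ← mul_assoc, ← map_mul, ← map_mul, mul_comm a b]

theorem lmul_comm_derivation (D : Derivation k A A) (a : A) :
    (D : A →ₗ[k] A) * Algebra.lmul k A a
      = Algebra.lmul k A a * (D : A →ₗ[k] A) + Algebra.lmul k A (D a) := by
  ext b
  simp [mul_comm]

theorem IsDiffOpLT.derivation_mul {m : ℕ} {P : Module.End k A} (hP : IsDiffOpLT k A m P)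
    (D : Derivation k A A) :
    IsDiffOpLT k A (m + 1) (((D : A →ₗ[k] A) : Module.End k A) * P) := by
  induction m generalizing P with
  | zero => simp only [IsDiffOpLT] at hP; simpa [hP] using IsDiffOpLT.zero _
  | succ m ih =>
    intro a
    convert (ih (hP a)).add (hP.lmul_mul (D a)) using 1
    rw [mul_sub, ← mul_assoc, ← mul_assoc, ← mul_assoc, lmul_comm_derivation]
    noncomm_ring

variable (k A) in
/-- The ring `𝒟(A, k)` of `k`-linear differential operators on `A`, as a subalgebra of
`End_k(A)`. -/
def diffOps : Subalgebra k (Module.End k A) where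
  carrier := {P | ∃ m, IsDiffOpLT k A m P}
  mul_mem' := by
    rintro P Q ⟨p, hP⟩ ⟨q, hQ⟩
    exact ⟨p + q, hP.mul hQ⟩
  add_mem' := by
    rintro P Q ⟨p, hP⟩ ⟨q, hQ⟩
    exact ⟨p + q, (hP.mono (by omega)).add (hQ.mono (by omega))⟩
  algebraMap_mem' c := by
    refine ⟨1, ?_⟩
    have := IsDiffOpLT.lmul (k := k) (algebraMap k A c)
    rwa [AlgHom.commutes] at this

variable (k A) in
/-- The ring `𝒟(A, k)`, as a type. It acts on `A` by evaluation. -/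
def DiffOp : Type v := diffOps k A

instance : Ring (DiffOp k A) := inferInstanceAs (Ring (diffOps k A))

instance : Algebra k (DiffOp k A) := inferInstanceAs (Algebra k (diffOps k A))

instance : Module (DiffOp k A) A := inferInstanceAs (Module (diffOps k A) A)

instance : IsScalarTower k (DiffOp k A) A := inferInstanceAs (IsScalarTower k (diffOps k A) A)

/-- Multiplication operators as differential operators. -/
def DiffOp.mulOp : A →ₐ[k] DiffOp k A :=
  (Algebra.lmul k A).codRestrict (diffOps k A) fun a => ⟨1, IsDiffOpLT.lmul a⟩

/-- Derivations as differential operators. -/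
def DiffOp.ofDerivation (D : Derivation k A A) : DiffOp k A :=
  ⟨(D : A →ₗ[k] A), 2, by
    have h := (IsDiffOpLT.lmul (k := k) (1 : A)).derivation_mul D
    rwa [map_one, mul_one] at h⟩

/-- `A` acts on `𝒟(A, k)` by left multiplication. -/
instance : Module A (DiffOp k A) := Module.compHom _ (DiffOp.mulOp (k := k) (A := A)).toRingHom

theorem DiffOp.smul_def (a : A) (P : DiffOp k A) : a • P = DiffOp.mulOp a * P := rfl

instance : IsScalarTower A (DiffOp k A) (DiffOp k A) := ⟨fun _ P Q => mul_assoc _ P Q⟩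

instance : IsScalarTower k A (DiffOp k A) := ⟨fun c a P => by
  simp [DiffOp.smul_def]⟩

@[simp] theorem DiffOp.mulOp_smul (a b : A) : (DiffOp.mulOp a : DiffOp k A) • b = a * b := rfl

@[simp] theorem DiffOp.ofDerivation_smul (D : Derivation k A A) (b : A) :
    DiffOp.ofDerivation D • b = D b := rfl

end DiffOp

/-! ### Monomials in commuting elements -/

section Monomials

variable {n : ℕ} {E : Type w} [Monoid E]

/-- `d_1^{α_1} ⋯ d_n^{α_n}` -/
def opMon (d : Fin n → E) (α : Fin n →₀ ℕ) : E := ((List.finRange n).map fun i => d i ^ α i).prod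

theorem opMon_zero (d : Fin n → E) : opMon d 0 = 1 := by
  simp [opMon]

theorem opMon_add_single (d : Fin n → E) (hd : ∀ i j, Commute (d i) (d j)) (α : Fin n →₀ ℕ)
    (i : Fin n) : opMon d (α + Finsupp.single i 1) = d i * opMon d α := by
  have key : ∀ l : List (Fin n), l.Nodup →
      (i ∈ l → (l.map fun j => d j ^ (α + Finsupp.single i 1 : Fin n →₀ ℕ) j).prod
        = d i * (l.map fun j => d j ^ α j).prod) ∧
      (i ∉ l → (l.map fun j => d j ^ (α + Finsupp.single i 1 : Fin n →₀ ℕ) j).prod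
        = (l.map fun j => d j ^ α j).prod) := by
    intro l
    induction l with
    | nil => simp
    | cons j l ih =>
      intro hl
      obtain ⟨hj, hl⟩ := List.nodup_cons.mp hl
      obtain ⟨h1, h2⟩ := ih hl
      simp only [List.map_cons, List.prod_cons]
      by_cases hij : j = i
      · subst hij
        refine ⟨fun _ => ?_, fun h => absurd List.mem_cons_self h⟩
        rw [h2 hj]
        simp [pow_succ', mul_assoc]
      · have e : (α + Finsupp.single i 1 : Fin n →₀ ℕ) j = α j := by simp [Ne.symm hij]
        rw [e]
        refine ⟨fun h => ?_, fun h => ?_⟩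
        · have hi : i ∈ l := (List.mem_cons.mp h).resolve_left (Ne.symm hij)
          rw [h1 hi, ← mul_assoc, ← mul_assoc, ((hd i j).pow_right _).eq]
        · rw [h2 fun hi => h (List.mem_cons_of_mem _ hi)]
  exact (key _ (List.nodup_finRange n)).1 (List.mem_finRange i)

theorem opMon_induction {p : (Fin n →₀ ℕ) → Prop} (h0 : p 0)
    (h1 : ∀ α i, p α → p (α + Finsupp.single i 1)) (α : Fin n →₀ ℕ) : p α := by
  have key : ∀ (m : ℕ) (i : Fin n) (β : Fin n →₀ ℕ), p β → p (β + Finsupp.single i m) := by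
    intro m i β hβ
    induction m with
    | zero => simpa using hβ
    | succ m ih => simpa [Finsupp.single_add, add_assoc] using h1 _ i ih
  induction α using Finsupp.induction with
  | zero => exact h0
  | single_add i m β _ _ ih => rw [add_comm]; exact key m i β ih

end Monomials

/-! ### Algebras with coordinates

The polynomial ring and the ring of formal power series are treated uniformly: both carry
coordinates `x_i` and commuting partial derivatives `∂_i` with `∂_i(x_j) = δ_{ij}`, and on both of
them a differential operator is determined by its values on the monomials. -/

/-- `x_1^{β_1} ⋯ x_n^{β_n}` -/
def coordMon {n : ℕ} {A : Type v} [CommRing A] (x : Fin n → A) (β : Fin n →₀ ℕ) : A :=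
  β.prod fun i e => x i ^ e

/-- Coordinates on a `k`-algebra. The two instances below are the polynomial ring and the ring of
formal power series. -/
class Coordinates (k : Type u) [Field k] (A : Type v) [CommRing A] [Algebra k A]
    (n : outParam ℕ) where
  x : Fin n → A
  pd : Fin n → Derivation k A A
  pd_comm : ∀ i j a, pd i (pd j a) = pd j (pd i a)
  pd_x : ∀ i j, pd i (x j) = if i = j then 1 else 0
  ext_mon : ∀ P : Module.End k A, P ∈ diffOps k A → (∀ β, P (coordMon x β) = 0) → P = 0

section PBW

variable {k : Type u} [Field k] {A : Type v} [CommRing A] [Algebra k A] {n : ℕ}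

theorem coordMon_zero (x : Fin n → A) : coordMon x 0 = 1 := Finsupp.prod_zero_index

theorem coordMon_add_single (x : Fin n → A) (β : Fin n →₀ ℕ) (i : Fin n) :
    coordMon x (β + Finsupp.single i 1) = x i * coordMon x β := by
  rw [coordMon, Finsupp.prod_add_index' (by simp) (by intros; rw [pow_add]),
    Finsupp.prod_single_index (by simp), pow_one, mul_comm]
  rfl

/-- `∑ c_α d^α` in a `k`-algebra `E` under `A`. -/
def opExpand {E : Type w} [Ring E] [Algebra k E] (φ : A →ₐ[k] E) (d : Fin n → E) :
    ((Fin n →₀ ℕ) →₀ A) →ₗ[k] E :=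
  Finsupp.lsum k fun α => (LinearMap.mulRight k (opMon d α)) ∘ₗ φ.toLinearMap

theorem opExpand_single {E : Type w} [Ring E] [Algebra k E] (φ : A →ₐ[k] E) (d : Fin n → E)
    (α : Fin n →₀ ℕ) (a : A) : opExpand φ d (Finsupp.single α a) = φ a * opMon d α := by
  simp [opExpand]

theorem natCast_isUnit [CharZero k] (c : ℕ) (hc : c ≠ 0) : IsUnit (c : A) := by
  have : IsUnit (c : k) := (Nat.cast_ne_zero.mpr hc).isUnit
  simpa using this.map (algebraMap k A)

theorem finsupp_eq_of_le_of_degree_le {β α : Fin n →₀ ℕ} (h : β ≤ α)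
    (hd : α.degree ≤ β.degree) : β = α := by
  obtain ⟨γ, rfl⟩ := exists_add_of_le h
  rw [map_add] at hd
  have : γ = 0 := (Finsupp.degree_eq_zero_iff γ).mp (by omega)
  rw [this, add_zero]

variable [Coordinates k A n]

open Coordinates

variable (k A) in
/-- The operator `∂_i` as an element of `𝒟(A, k)`. -/
def dd (i : Fin n) : DiffOp k A := DiffOp.ofDerivation (pd i)

theorem dd_comm (i j : Fin n) : Commute (dd k A i) (dd k A j) :=
  Subtype.ext (LinearMap.ext fun a => pd_comm i j a)

theorem dd_mulOp (i : Fin n) (a : A) :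
    dd k A i * DiffOp.mulOp a = DiffOp.mulOp a * dd k A i + DiffOp.mulOp (pd (k := k) i a) :=
  Subtype.ext (lmul_comm_derivation _ a)

theorem pd_coordMon (i : Fin n) (β : Fin n →₀ ℕ) :
    pd (k := k) i (coordMon (x k : Fin n → A) β)
      = (β i : A) * coordMon (x k) (β - Finsupp.single i 1) := by
  induction β using opMon_induction with
  | h0 => simp [coordMon_zero]
  | h1 β j ih =>
    rw [coordMon_add_single, Derivation.leibniz, ih, pd_x]
    by_cases hij : i = j
    · subst hij
      have e : β + Finsupp.single i 1 - Finsupp.single i 1 = β := by simp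
      rw [e]
      by_cases h0 : β i = 0
      · simp [h0]
      · have e2 : β - Finsupp.single i 1 + Finsupp.single i 1 = β := by
          ext l
          by_cases hl : i = l
          · subst hl; simp; omega
          · simp [Finsupp.single_eq_of_ne' hl]
        have e3 := coordMon_add_single (x k : Fin n → A) (β - Finsupp.single i 1) i
        rw [e2] at e3
        simp only [smul_eq_mul, if_true, mul_one, Finsupp.add_apply, Finsupp.single_eq_same]
        rw [mul_left_comm, ← e3]
        push_cast
        ring
    · have hji : (Finsupp.single j 1 : Fin n →₀ ℕ) i = 0 := Finsupp.single_eq_of_ne hij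
      by_cases h0 : β i = 0
      · simp [h0, hji, hij]
      · have e2 : β + Finsupp.single j 1 - Finsupp.single i 1
            = β - Finsupp.single i 1 + Finsupp.single j 1 := by
          ext l
          by_cases hl : i = l
          · subst hl; simp [hji]
          · simp [Finsupp.single_eq_of_ne' hl]
        rw [e2, coordMon_add_single]
        simp [hij, hji]
        ring

theorem opMon_dd_commute (α : Fin n →₀ ℕ) (i : Fin n) :
    Commute (dd k A i) (opMon (dd k A) α) := by
  induction α using opMon_induction with
  | h0 => rw [opMon_zero]; exact Commute.one_right _
  | h1 α j ih => rw [opMon_add_single _ dd_comm]; exact (dd_comm i j).mul_right ih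

theorem opMon_dd_coordMon (α : Fin n →₀ ℕ) :
    (∀ β, ¬ α ≤ β → opMon (dd k A) α • coordMon (x k : Fin n → A) β = 0) ∧
      ∃ c : ℕ, c ≠ 0 ∧ opMon (dd k A) α • coordMon (x k : Fin n → A) α = (c : A) := by
  induction α using opMon_induction with
  | h0 =>
    refine ⟨fun β h => absurd (zero_le (a := β)) h, 1, one_ne_zero, ?_⟩
    rw [opMon_zero, one_smul, coordMon_zero, Nat.cast_one]
  | h1 α i ih =>
    obtain ⟨h1, c, hc, h2⟩ := ih
    have key : ∀ β, opMon (dd k A) (α + Finsupp.single i 1) • coordMon (x k : Fin n → A) β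
        = (β i : k) • (opMon (dd k A) α • coordMon (x k : Fin n → A) (β - Finsupp.single i 1)) := by
      intro β
      rw [opMon_add_single _ dd_comm, (opMon_dd_commute α i).eq, mul_smul]
      have : dd k A i • coordMon (x k : Fin n → A) β
          = (β i : k) • coordMon (x k : Fin n → A) (β - Finsupp.single i 1) := by
        rw [dd, DiffOp.ofDerivation_smul, pd_coordMon, Algebra.smul_def, map_natCast]
      rw [this, smul_comm]
    refine ⟨fun β hβ => ?_, (α i + 1) * c, by positivity, ?_⟩
    · rw [key]
      by_cases h0 : β i = 0
      · simp [h0]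
      · rw [h1, smul_zero]
        intro hle
        apply hβ
        intro l
        have := hle l
        by_cases hl : i = l
        · subst hl; simp at this ⊢; omega
        · simpa [Finsupp.single_eq_of_ne' hl] using this
    · rw [key, add_tsub_cancel_right, h2, Algebra.smul_def, map_natCast]
      simp

theorem opExpand_dd_injective [CharZero k] :
    Function.Injective (opExpand (DiffOp.mulOp (k := k) (A := A)) (dd k A)) := by
  refine (injective_iff_map_eq_zero _).mpr ?_
  intro c hc
  by_contra hne
  obtain ⟨α, hα, hmin⟩ := Finset.exists_min_image c.support Finsupp.degree
    (Finsupp.support_nonempty_iff.mpr hne)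
  have h := congrArg (fun P : DiffOp k A => P • coordMon (x k : Fin n → A) α) hc
  simp only [zero_smul] at h
  rw [opExpand, Finsupp.lsum_apply, Finsupp.sum, Finset.sum_smul, Finset.sum_eq_single α] at h
  · obtain ⟨_, N, hN, h2⟩ := opMon_dd_coordMon (k := k) (A := A) α
    simp only [LinearMap.comp_apply, LinearMap.mulRight_apply, AlgHom.toLinearMap_apply, mul_smul,
      h2, DiffOp.mulOp_smul] at h
    rw [(natCast_isUnit (k := k) N hN).mul_left_eq_zero] at h
    exact (Finsupp.mem_support_iff.mp hα) h
  · intro β hβ hβα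
    simp only [LinearMap.comp_apply, LinearMap.mulRight_apply, AlgHom.toLinearMap_apply, mul_smul]
    rw [(opMon_dd_coordMon β).1, smul_zero]
    intro hle
    exact hβα (finsupp_eq_of_le_of_degree_le hle (hmin β hβ))
  · exact fun h => absurd hα h

theorem opMon_dd_order (α : Fin n →₀ ℕ) :
    IsDiffOpLT k A (α.degree + 1) (opMon (dd k A) α : DiffOp k A).1 := by
  induction α using opMon_induction with
  | h0 =>
    rw [opMon_zero, map_zero]
    have := IsDiffOpLT.lmul (k := k) (1 : A)
    rwa [map_one] at this
  | h1 α i ih =>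
    rw [opMon_add_single _ dd_comm, map_add, Finsupp.degree_single]
    exact ih.derivation_mul _

theorem exists_interpolation [CharZero k] (m : ℕ) (g : (Fin n →₀ ℕ) → A) :
    ∃ c, IsDiffOpLT k A m (opExpand (DiffOp.mulOp (k := k) (A := A)) (dd k A) c).1 ∧
      ∀ β : Fin n →₀ ℕ, β.degree < m →
        opExpand (DiffOp.mulOp (k := k) (A := A)) (dd k A) c • coordMon (x k : Fin n → A) β
          = g β := by
  induction m with
  | zero => exact ⟨0, by rw [map_zero]; exact IsDiffOpLT.zero _, fun β h => absurd h (by omega)⟩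
  | succ m ih =>
    obtain ⟨c, hc, hg⟩ := ih
    have hS := Finsupp.finite_of_degree_eq (σ := Fin n) m
    have hN : ∀ α : Fin n →₀ ℕ, ∃ b : A,
        b * (opMon (dd k A) α • coordMon (x k : Fin n → A) α) = g α
          - opExpand (DiffOp.mulOp (k := k) (A := A)) (dd k A) c • coordMon (x k : Fin n → A) α := by
      intro α
      obtain ⟨N, hN, h2⟩ := (opMon_dd_coordMon (k := k) (A := A) α).2
      obtain ⟨u, hu⟩ := natCast_isUnit (k := k) (A := A) N hN
      refine ⟨(g α - opExpand (DiffOp.mulOp (k := k) (A := A)) (dd k A) c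
        • coordMon (x k : Fin n → A) α) * ↑u⁻¹, ?_⟩
      rw [h2, ← hu, mul_assoc, Units.inv_mul, mul_one]
    choose b hb using hN
    have ev : ∀ β : Fin n →₀ ℕ,
        opExpand (DiffOp.mulOp (k := k) (A := A)) (dd k A)
          (∑ α ∈ hS.toFinset, Finsupp.single α (b α)) • coordMon (x k : Fin n → A) β
        = ∑ α ∈ hS.toFinset, b α * (opMon (dd k A) α • coordMon (x k : Fin n → A) β) := by
      intro β
      rw [map_sum, Finset.sum_smul]
      refine Finset.sum_congr rfl fun α _ => ?_
      rw [opExpand_single, mul_smul, DiffOp.mulOp_smul]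
    refine ⟨c + ∑ α ∈ hS.toFinset, Finsupp.single α (b α), ?_, ?_⟩
    · rw [map_add]
      refine IsDiffOpLT.add hc.succ ?_
      rw [map_sum]
      refine Finset.sum_induction _ (fun P : DiffOp k A => IsDiffOpLT k A (m + 1) P.1)
        (fun P Q hP hQ => hP.add hQ) (IsDiffOpLT.zero _) fun α hα => ?_
      rw [opExpand_single]
      have := opMon_dd_order (k := k) (A := A) α
      rw [(hS.mem_toFinset.mp hα : α.degree = m)] at this
      exact this.lmul_mul _
    · intro β hβ
      rw [map_add, add_smul, ev]
      by_cases hlt : β.degree < m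
      · rw [hg β hlt, Finset.sum_eq_zero, add_zero]
        intro α hα
        rw [(opMon_dd_coordMon α).1, mul_zero]
        intro hle
        have := Finsupp.degree_mono hle
        rw [(hS.mem_toFinset.mp hα : α.degree = m)] at this
        omega
      · have hβm : β.degree = m := by omega
        rw [Finset.sum_eq_single β, hb, add_sub_cancel]
        · intro α hα hne
          rw [(opMon_dd_coordMon α).1, mul_zero]
          intro hle
          refine hne (finsupp_eq_of_le_of_degree_le hle ?_)
          rw [(hS.mem_toFinset.mp hα : α.degree = m), hβm]
        · intro h
          exact absurd (hS.mem_toFinset.mpr hβm) h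

theorem IsDiffOpLT.coordMon_eq_zero {m : ℕ} {P : Module.End k A} (hP : IsDiffOpLT k A m P)
    (h : ∀ β : Fin n →₀ ℕ, β.degree < m → P (coordMon (x k : Fin n → A) β) = 0)
    (β : Fin n →₀ ℕ) : P (coordMon (x k : Fin n → A) β) = 0 := by
  induction m generalizing P β with
  | zero => simp only [IsDiffOpLT] at hP; simp [hP]
  | succ m ih =>
    have key : ∀ i (β : Fin n →₀ ℕ), P (x k i * coordMon (x k : Fin n → A) β)
        = x k i * P (coordMon (x k : Fin n → A) β) := by
      intro i β
      have := ih (hP (x k i)) (fun γ hγ => ?_) β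
      · simpa [sub_eq_zero] using this
      · have h1 := h (γ + Finsupp.single i 1) (by
          rw [map_add, Finsupp.degree_single]; omega)
        rw [coordMon_add_single] at h1
        simp [h1, h γ (by omega)]
    induction β using opMon_induction with
    | h0 => exact h 0 (by simp)
    | h1 β i ihβ => rw [coordMon_add_single, key, ihβ, mul_zero]

theorem opExpand_dd_surjective [CharZero k] :
    Function.Surjective (opExpand (DiffOp.mulOp (k := k) (A := A)) (dd k A)) := by
  rintro ⟨P, m, hP⟩
  obtain ⟨c, hc, hg⟩ := exists_interpolation (k := k) m fun β => P (coordMon (x k : Fin n → A) β)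
  refine ⟨c, Subtype.ext (Eq.symm (sub_eq_zero.mp ?_))⟩
  have hneg : IsDiffOpLT k A m
      (P - (opExpand (DiffOp.mulOp (k := k) (A := A)) (dd k A) c).1) := by
    have h1 := hc.lmul_mul (-1)
    have h2 := hP.add h1
    convert h2 using 1
    ext b
    simp [sub_eq_add_neg]
  refine ext_mon _ ⟨m, hneg⟩ (hneg.coordMon_eq_zero fun β hβ => ?_)
  exact sub_eq_zero.mpr (hg β hβ).symm

theorem DiffOp.exists_lift [CharZero k] {E : Type w} [Ring E] [Algebra k E] (φ : A →ₐ[k] E)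
    (d : Fin n → E) (hd : ∀ i j, Commute (d i) (d j))
    (hφ : ∀ i a, d i * φ a = φ a * d i + φ (pd (k := k) i a)) :
    ∃ L : DiffOp k A →ₐ[k] E, (∀ a, L (DiffOp.mulOp a) = φ a) ∧ ∀ i, L (dd k A i) = d i := by
  obtain ⟨s, hs⟩ : ∃ s : DiffOp k A → ((Fin n →₀ ℕ) →₀ A),
      ∀ P, opExpand (DiffOp.mulOp (k := k) (A := A)) (dd k A) (s P) = P :=
    ⟨fun P => (opExpand_dd_surjective P).choose, fun P => (opExpand_dd_surjective P).choose_spec⟩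
  obtain ⟨L, hL⟩ : ∃ L : DiffOp k A → E, ∀ c,
      L (opExpand (DiffOp.mulOp (k := k) (A := A)) (dd k A) c) = opExpand φ d c :=
    ⟨fun P => opExpand φ d (s P), fun c => congrArg _ (opExpand_dd_injective (hs _))⟩
  have hadd : ∀ P Q, L (P + Q) = L P + L Q := by
    intro P Q
    rw [← hs P, ← hs Q, ← map_add, hL, hL, hL, map_add]
  have hL1 : ∀ a α, L (DiffOp.mulOp a * opMon (dd k A) α) = φ a * opMon d α := by
    intro a α
    have h := hL (Finsupp.single α a)
    rwa [opExpand_single, opExpand_single] at h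
  have ind : ∀ (p : DiffOp k A → Prop), (∀ a α, p (DiffOp.mulOp a * opMon (dd k A) α)) →
      (∀ P Q, p P → p Q → p (P + Q)) → ∀ P, p P := by
    intro p h1 h2 P
    rw [← hs P]
    induction s P using Finsupp.induction_linear with
    | zero => rw [map_zero]; simpa using h1 0 0
    | add c c' h h' => rw [map_add]; exact h2 _ _ h h'
    | single α a => rw [opExpand_single]; exact h1 a α
  have hmulOp : ∀ a Q, L (DiffOp.mulOp a * Q) = φ a * L Q := by
    intro a
    refine ind _ (fun b α => ?_) (fun P Q hP hQ => ?_)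
    · rw [← mul_assoc, ← map_mul, hL1, hL1, map_mul, mul_assoc]
    · rw [mul_add, hadd, hadd, hP, hQ, mul_add]
  have hdd : ∀ i Q, L (dd k A i * Q) = d i * L Q := by
    intro i
    refine ind _ (fun b α => ?_) (fun P Q hP hQ => ?_)
    · rw [← mul_assoc, dd_mulOp, add_mul, mul_assoc, ← opMon_add_single _ dd_comm, hadd, hL1, hL1,
        hL1, opMon_add_single _ hd, ← mul_assoc, ← mul_assoc, hφ, add_mul]
    · rw [mul_add, hadd, hadd, hP, hQ, mul_add]
  have hone : L 1 = 1 := by simpa [opMon_zero] using hL1 1 0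
  have hA : ∀ a, L (DiffOp.mulOp a) = φ a := fun a => by simpa [hone] using hmulOp a 1
  have hmul : ∀ P Q, L (P * Q) = L P * L Q := by
    refine ind _ (fun a α Q => ?_) (fun P P' hP hP' Q => ?_)
    · rw [mul_assoc, hmulOp, hmulOp, mul_assoc]
      congr 1
      induction α using opMon_induction with
      | h0 => rw [opMon_zero, hone, one_mul, one_mul]
      | h1 α i ih => rw [opMon_add_single _ dd_comm, mul_assoc, hdd, hdd, ih, mul_assoc]
    · rw [add_mul, hadd, hadd, hP, hP', add_mul]
  refine ⟨
    { toFun := L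
      map_one' := hone
      map_mul' := hmul
      map_zero' := by simpa using hA 0
      map_add' := hadd
      commutes' := fun c => ?_ }, hA, fun i => by simpa [hone] using hdd i 1⟩
  have := hA (algebraMap k A c)
  rwa [AlgHom.commutes, AlgHom.commutes] at this

/-- `𝒟(A, k)` is generated by `A` and `∂_1, …, ∂_n`. -/
theorem DiffOp.gen_induction [CharZero k] {p : DiffOp k A → Prop}
    (hA : ∀ a, p (DiffOp.mulOp a)) (hdd : ∀ i, p (dd k A i))
    (hadd : ∀ P Q, p P → p Q → p (P + Q)) (hmul : ∀ P Q, p P → p Q → p (P * Q))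
    (P : DiffOp k A) : p P := by
  obtain ⟨c, rfl⟩ := opExpand_dd_surjective P
  induction c using Finsupp.induction_linear with
  | zero => rw [map_zero]; simpa using hA 0
  | add c c' h h' => rw [map_add]; exact hadd _ _ h h'
  | single α a =>
    rw [opExpand_single]
    refine hmul _ _ (hA a) ?_
    induction α using opMon_induction with
    | h0 => rw [opMon_zero]; simpa using hA 1
    | h1 α i ih => rw [opMon_add_single _ dd_comm]; exact hmul _ _ (hdd i) ih

/-- The algebra map `𝒟(A, k) → E` determined by its restriction `φ` to `A` and by the images `d_i`
of the `∂_i`. -/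
def DiffOp.lift [CharZero k] {E : Type w} [Ring E] [Algebra k E] (φ : A →ₐ[k] E)
    (d : Fin n → E) (hd : ∀ i j, Commute (d i) (d j))
    (hφ : ∀ i a, d i * φ a = φ a * d i + φ (pd (k := k) i a)) : DiffOp k A →ₐ[k] E :=
  (DiffOp.exists_lift φ d hd hφ).choose

theorem DiffOp.lift_mulOp [CharZero k] {E : Type w} [Ring E] [Algebra k E] (φ : A →ₐ[k] E)
    (d : Fin n → E) (hd : ∀ i j, Commute (d i) (d j))
    (hφ : ∀ i a, d i * φ a = φ a * d i + φ (pd (k := k) i a)) (a : A) :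
    DiffOp.lift φ d hd hφ (DiffOp.mulOp a) = φ a :=
  (DiffOp.exists_lift φ d hd hφ).choose_spec.1 a

theorem DiffOp.lift_dd [CharZero k] {E : Type w} [Ring E] [Algebra k E] (φ : A →ₐ[k] E)
    (d : Fin n → E) (hd : ∀ i j, Commute (d i) (d j))
    (hφ : ∀ i a, d i * φ a = φ a * d i + φ (pd (k := k) i a)) (i : Fin n) :
    DiffOp.lift φ d hd hφ (dd k A i) = d i :=
  (DiffOp.exists_lift φ d hd hφ).choose_spec.2 i

end PBW

/-! ### Polynomials and formal power series -/

section Instances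

variable (k : Type u) [Field k] (n : ℕ)

/-- The polynomial ring `R = k[x_1, …, x_n]`. -/
abbrev PolyR : Type u := MvPolynomial (Fin n) k

/-- The formal power series ring `R̂ = k[[x_1, …, x_n]]`. -/
abbrev PowR : Type u := MvPowerSeries (Fin n) k

theorem coordMon_poly (β : Fin n →₀ ℕ) :
    coordMon (MvPolynomial.X : Fin n → PolyR k n) β = MvPolynomial.monomial β 1 := by
  rw [MvPolynomial.monomial_eq, map_one, one_mul]
  rfl

theorem coordMon_pow (β : Fin n →₀ ℕ) :
    coordMon (MvPowerSeries.X : Fin n → PowR k n) β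
      = ((MvPolynomial.monomial β (1 : k) : PolyR k n) : PowR k n) := by
  rw [← coordMon_poly]
  induction β using opMon_induction with
  | h0 => rw [coordMon_zero, coordMon_zero, MvPolynomial.coe_one]
  | h1 β i ih =>
    rw [coordMon_add_single, coordMon_add_single, MvPolynomial.coe_mul, MvPolynomial.coe_X, ih]

instance polyCoordinates : Coordinates k (PolyR k n) n where
  x := MvPolynomial.X
  pd := MvPolynomial.pderiv
  pd_comm i j a := by
    ext m
    simp only [MvPolynomial.coeff_pderiv, Finsupp.add_apply]
    rw [add_right_comm]
    by_cases h : i = j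
    · subst h; rfl
    · rw [Finsupp.single_eq_of_ne h, Finsupp.single_eq_of_ne' h]
      push_cast
      ring
  pd_x i j := by
    rw [MvPolynomial.pderiv_X, Pi.single_apply]
    simp only [eq_comm]
  ext_mon P _ h := by
    refine (MvPolynomial.basisMonomials (Fin n) k).ext fun β => ?_
    simpa [coordMon_poly] using h β

/-- Power series of order at least `N`. -/
def HasOrder (N : ℕ) (f : PowR k n) : Prop := ∀ β : Fin n →₀ ℕ, β.degree < N →
  MvPowerSeries.coeff β f = 0

variable {k n}

theorem HasOrder.mul_left {N : ℕ} {f : PowR k n} (hf : HasOrder k n N f) (g : PowR k n) :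
    HasOrder k n N (g * f) := by
  classical
  intro β hβ
  rw [MvPowerSeries.coeff_mul]
  refine Finset.sum_eq_zero fun p hp => ?_
  rw [hf p.2, mul_zero]
  have := congrArg Finsupp.degree (Finset.HasAntidiagonal.mem_antidiagonal.mp hp)
  rw [map_add] at this
  omega

theorem HasOrder.sum {ι : Type*} (s : Finset ι) {N : ℕ} {f : ι → PowR k n}
    (hf : ∀ i ∈ s, HasOrder k n N (f i)) : HasOrder k n N (∑ i ∈ s, f i) := by
  intro β hβ
  rw [map_sum]
  exact Finset.sum_eq_zero fun i hi => hf i hi β hβ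

theorem HasOrder.add {N : ℕ} {f g : PowR k n} (hf : HasOrder k n N f) (hg : HasOrder k n N g) :
    HasOrder k n N (f + g) := by
  intro β hβ
  rw [map_add, hf β hβ, hg β hβ, add_zero]

theorem coeff_X_mul_pow (i : Fin n) (f : PowR k n) (β : Fin n →₀ ℕ) :
    MvPowerSeries.coeff β (MvPowerSeries.X i * f)
      = if β i = 0 then 0 else MvPowerSeries.coeff (β - Finsupp.single i 1) f := by
  classical
  rw [MvPowerSeries.X, MvPowerSeries.coeff_monomial_mul, one_mul]
  by_cases h : β i = 0
  · rw [if_pos h, if_neg]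
    intro hle
    have := hle i
    simp [h] at this
  · rw [if_neg h, if_pos]
    exact Finsupp.single_le_iff.mpr (by omega)

theorem HasOrder.X_mul {N : ℕ} {f : PowR k n} (hf : HasOrder k n N f) (i : Fin n) :
    HasOrder k n (N + 1) (MvPowerSeries.X i * f) := by
  intro β hβ
  rw [coeff_X_mul_pow]
  split_ifs with h
  · rfl
  · apply hf
    have e : β - Finsupp.single i 1 + Finsupp.single i 1 = β :=
      tsub_add_cancel_of_le (Finsupp.single_le_iff.mpr (by omega))
    have := congrArg Finsupp.degree e
    rw [map_add, Finsupp.degree_single] at this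
    omega

theorem HasOrder.exists_sum {N : ℕ} {f : PowR k n} (hf : HasOrder k n (N + 1) f) :
    ∃ g : Fin n → PowR k n, (∀ i, HasOrder k n N (g i)) ∧ f = ∑ i, MvPowerSeries.X i * g i := by
  classical
  let pick : (Fin n →₀ ℕ) → Fin n → Prop := fun β i => β i ≠ 0 ∧ ∀ j < i, β j = 0
  obtain ⟨g, hg⟩ : ∃ g : Fin n → PowR k n, ∀ i γ, MvPowerSeries.coeff γ (g i)
      = if pick (γ + Finsupp.single i 1) i then
        MvPowerSeries.coeff (γ + Finsupp.single i 1) f else 0 :=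
    ⟨fun i γ => if pick (γ + Finsupp.single i 1) i then
      MvPowerSeries.coeff (γ + Finsupp.single i 1) f else 0, fun _ _ => rfl⟩
  refine ⟨g, fun i γ hγ => ?_, ?_⟩
  · rw [hg]
    split_ifs
    · apply hf; rw [map_add, Finsupp.degree_single]; omega
    · rfl
  · ext β
    rw [map_sum]
    have e : ∀ i, MvPowerSeries.coeff β (MvPowerSeries.X i * g i)
        = if pick β i then MvPowerSeries.coeff β f else 0 := by
      intro i
      rw [coeff_X_mul_pow]
      by_cases h : β i = 0
      · rw [if_pos h, if_neg (fun hp => hp.1 h)]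
      · rw [if_neg h, hg, tsub_add_cancel_of_le (Finsupp.single_le_iff.mpr (by omega))]
    simp only [e]
    by_cases hβ : β = 0
    · subst hβ
      rw [hf 0 (by simp)]
      simp
    · have hne : (Finset.univ.filter fun i => β i ≠ 0).Nonempty := by
        obtain ⟨i, hi⟩ := Finsupp.ne_iff.mp hβ
        exact ⟨i, by simpa using hi⟩
      obtain ⟨i₀, hmem, hle⟩ : ∃ i₀ ∈ Finset.univ.filter fun i => β i ≠ 0,
          ∀ j ∈ Finset.univ.filter fun i => β i ≠ 0, i₀ ≤ j :=
        ⟨_, Finset.min'_mem _ hne, fun j hj => Finset.min'_le _ j hj⟩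
      have hpick : pick β i₀ := by
        refine ⟨by simpa using hmem, fun j hj => ?_⟩
        by_contra hj0
        exact absurd (hle j (by simpa using hj0)) (not_le.mpr hj)
      rw [Finset.sum_eq_single i₀, if_pos hpick]
      · intro j _ hj
        rw [if_neg]
        intro hp
        rcases lt_or_gt_of_ne hj with h | h
        · exact hp.1 (hpick.2 j h)
        · exact hpick.1 (hp.2 i₀ h)
      · intro h; exact absurd (Finset.mem_univ _) h

theorem IsDiffOpLT.hasOrder {m : ℕ} {P : Module.End k (PowR k n)}
    (hP : IsDiffOpLT k (PowR k n) m P) (N : ℕ) (f : PowR k n) (hf : HasOrder k n (N + m) f) :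
    HasOrder k n N (P f) := by
  induction m generalizing P N f with
  | zero =>
    simp only [IsDiffOpLT] at hP
    subst hP
    intro β _
    simp
  | succ m ih =>
    induction N generalizing f with
    | zero => intro β h; exact absurd h (by omega)
    | succ N ihN =>
      obtain ⟨g, hg, rfl⟩ := HasOrder.exists_sum (N := N + 1 + m) hf
      rw [map_sum]
      refine HasOrder.sum _ fun i _ => ?_
      have h1 := ih (hP (MvPowerSeries.X i)) (N + 1) (g i) (hg i)
      have h2 := (ihN (g i) (by
        have := hg i
        rwa [show N + 1 + m = N + (m + 1) by omega] at this)).X_mul i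
      have e : P (MvPowerSeries.X i * g i) = (P * Algebra.lmul k (PowR k n) (MvPowerSeries.X i)
          - Algebra.lmul k (PowR k n) (MvPowerSeries.X i) * P) (g i)
          + MvPowerSeries.X i * P (g i) := by simp
      rw [e]
      exact h1.add h2

variable (k n)

instance powCoordinates : Coordinates k (PowR k n) n where
  x := MvPowerSeries.X
  pd := MvPowerSeries.pderiv k
  pd_comm i j a := by
    ext m
    simp only [MvPowerSeries.coeff_pderiv, Finsupp.add_apply]
    rw [add_right_comm]
    by_cases h : i = j
    · subst h; rfl
    · rw [Finsupp.single_eq_of_ne h, Finsupp.single_eq_of_ne' h]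
      push_cast
      ring
  pd_x i j := by
    rw [MvPowerSeries.pderiv_X, Pi.single_apply]
    simp only [eq_comm]
  ext_mon P hP h := by
    obtain ⟨m, hm⟩ := hP
    have hpoly : ∀ q : PolyR k n, P (q : PowR k n) = 0 := by
      intro q
      induction q using MvPolynomial.induction_on' with
      | monomial β a =>
        have := h β
        rw [coordMon_pow] at this
        have e : ((MvPolynomial.monomial β a : PolyR k n) : PowR k n)
            = a • ((MvPolynomial.monomial β (1 : k) : PolyR k n) : PowR k n) := by
          rw [← mul_one a, ← smul_eq_mul, ← MvPolynomial.smul_monomial]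
          ext; simp
        rw [e, map_smul, this, smul_zero]
      | add p q hp hq => rw [MvPolynomial.coe_add, map_add, hp, hq, add_zero]
    ext f β
    have hord : HasOrder k n (β.degree + 1 + m)
        (f - (MvPowerSeries.truncTotal (β.degree + 1 + m) f : PolyR k n)) := by
      intro γ hγ
      rw [map_sub, MvPolynomial.coeff_coe, MvPowerSeries.coeff_truncTotal _ hγ, sub_self]
    have := hm.hasOrder _ _ hord β (by omega)
    rw [map_sub, hpoly, sub_zero] at this
    simpa using this

end Instances

/-! ### Transposition -/

/-- The transpose `N^τ` of a left `𝒟(A, k)`-module `N`: the same additive group with the right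
action `x · δ = τ(δ) x`, i.e. a module over the opposite ring (see the instance below). -/
def Transpose (_k : Type u) (_A : Type v) (N : Type w) : Type w := N

section Transposition

open Coordinates

variable (k : Type u) [Field k] [CharZero k] (A : Type v) [CommRing A] [Algebra k A] {n : ℕ}
  [Coordinates k A n]

/-- The standard transposition, as an algebra map from `𝒟(A, k)` to its opposite: it fixes `A` and
sends `∂_i` to `-∂_i`. -/
def transposition : DiffOp k A →ₐ[k] (DiffOp k A)ᵐᵒᵖ :=
  DiffOp.lift ((DiffOp.mulOp (k := k) (A := A)).toOpposite fun a b => by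
      rw [commute_iff_eq, ← map_mul, ← map_mul, mul_comm])
    (fun i => op (-dd k A i))
    (fun i j => by
      rw [commute_iff_eq, ← op_mul, ← op_mul, neg_mul_neg, neg_mul_neg, (dd_comm i j).eq])
    (fun i a => by
      show op (-dd k A i) * op (DiffOp.mulOp a)
        = op (DiffOp.mulOp a) * op (-dd k A i) + op (DiffOp.mulOp (pd (k := k) i a))
      rw [← op_mul, ← op_mul, ← op_add, neg_mul, mul_neg, dd_mulOp, neg_add, neg_add_cancel_right])

/-- `τ(δ)` -/
def tau (δ : DiffOp k A) : DiffOp k A := unop (transposition k A δ)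

/-- `τ(f ∂^α) = (-1)^{|α|} ∂^α f` -/
theorem tau_mulOp_mul_opMon (f : A) (α : Fin n →₀ ℕ) :
    tau k A (DiffOp.mulOp f * opMon (dd k A) α)
      = (-1) ^ α.degree * opMon (dd k A) α * DiffOp.mulOp f := by
  rw [tau, map_mul, unop_mul, transposition, DiffOp.lift_mulOp]
  congr 1
  induction α using opMon_induction with
  | h0 => simp [opMon_zero]
  | h1 α i ih =>
    rw [opMon_add_single _ dd_comm, map_mul, unop_mul, ih, DiffOp.lift_dd, unop_op, map_add,
      Finsupp.degree_single, pow_succ, (opMon_dd_commute α i).eq]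
    noncomm_ring

instance (N : Type w) [AddCommGroup N] : AddCommGroup (Transpose k A N) :=
  inferInstanceAs (AddCommGroup N)

instance (N : Type w) [AddCommGroup N] [Module k N] : Module k (Transpose k A N) :=
  inferInstanceAs (Module k N)

/-- The identity `N → N^τ`. -/
def Transpose.of {N : Type w} [AddCommGroup N] [Module k N] : N ≃ₗ[k] Transpose k A N :=
  LinearEquiv.refl k N

instance (N : Type w) [AddCommGroup N] [Module k N] [Module (DiffOp k A) N] :
    Module (DiffOp k A)ᵐᵒᵖ (Transpose k A N) where
  smul p y := Transpose.of k A (tau k A (unop p) • (Transpose.of k A).symm y)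
  one_smul y := by
    show tau k A (1 : DiffOp k A) • (Transpose.of k A).symm y = _
    rw [tau, map_one, unop_one, one_smul]
    rfl
  mul_smul p q y := by
    show tau k A (unop q * unop p) • (Transpose.of k A).symm y
      = tau k A (unop p) • tau k A (unop q) • (Transpose.of k A).symm y
    rw [← mul_smul, tau, map_mul, unop_mul]
    rfl
  smul_zero p := smul_zero (M := DiffOp k A) (A := N) _
  smul_add p := smul_add (M := DiffOp k A) (A := N) _
  add_smul p q y := by
    show tau k A (unop p + unop q) • (Transpose.of k A).symm y
      = tau k A (unop p) • (Transpose.of k A).symm y + tau k A (unop q) • (Transpose.of k A).symm y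
    rw [← add_smul, tau, map_add, unop_add]
    rfl
  zero_smul y := by
    show tau k A (0 : DiffOp k A) • (Transpose.of k A).symm y = (0 : N)
    rw [tau, map_zero, unop_zero, zero_smul]

theorem Transpose.op_smul_of {N : Type w} [AddCommGroup N] [Module k N] [Module (DiffOp k A) N]
    (δ : DiffOp k A) (y : N) :
    op δ • Transpose.of k A y = Transpose.of k A (tau k A δ • y) := rfl

end Transposition

/-! ### The ring map `𝒟 → 𝒟̂` and the completion `M̂ = R̂ ⊗_R M` -/

section Completion

variable (k : Type u) [Field k] [CharZero k] (n : ℕ)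

/-- The inclusion `R → R̂`. -/
def polyToPow : PolyR k n →ₐ[k] PowR k n := MvPolynomial.coeToMvPowerSeries.algHom k

theorem polyToPow_eq_algebraMap (r : PolyR k n) :
    polyToPow k n r = algebraMap (PolyR k n) (PowR k n) r := rfl

theorem pd_polyToPow (i : Fin n) (r : PolyR k n) :
    Coordinates.pd (k := k) i (polyToPow k n r)
      = polyToPow k n (Coordinates.pd (k := k) i r) := by
  have h := MvPowerSeries.pderiv_coe (i := i) r
  have e : ∀ q : PolyR k n, polyToPow k n q = (q : PowR k n) := fun q => by simp [polyToPow]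
  rw [e, e]
  exact h

/-- The inclusion of `𝒟 = 𝒟(R, k)` in `𝒟̂ = 𝒟(R̂, k)`, which extends `R → R̂` and sends `∂_i` to
`∂_i`. -/
def extendOp : DiffOp k (PolyR k n) →ₐ[k] DiffOp k (PowR k n) :=
  DiffOp.lift (DiffOp.mulOp.comp (polyToPow k n)) (dd k (PowR k n)) dd_comm fun i a => by
    simp only [AlgHom.comp_apply]
    rw [dd_mulOp, pd_polyToPow]

/-- `extendOp` extends operators from `R` to `R̂`. -/
theorem extendOp_smul_polyToPow (δ : DiffOp k (PolyR k n)) (r : PolyR k n) :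
    extendOp k n δ • polyToPow k n r = polyToPow k n (δ • r) := by
  induction δ using DiffOp.gen_induction generalizing r with
  | hA a => rw [extendOp, DiffOp.lift_mulOp]; simp
  | hdd i => rw [extendOp, DiffOp.lift_dd]; exact pd_polyToPow k n i r
  | hadd P Q hP hQ => rw [map_add, add_smul, add_smul, hP, hQ, map_add]
  | hmul P Q hP hQ => rw [map_mul, mul_smul, mul_smul, hQ, hP]

theorem tau_extendOp (δ : DiffOp k (PolyR k n)) :
    tau k (PowR k n) (extendOp k n δ) = extendOp k n (tau k (PolyR k n) δ) := by
  induction δ using DiffOp.gen_induction with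
  | hA a =>
    have e : ∀ b : PolyR k n, extendOp k n (DiffOp.mulOp b) = DiffOp.mulOp (polyToPow k n b) :=
      DiffOp.lift_mulOp _ _ _ _
    rw [e, tau, tau, transposition, DiffOp.lift_mulOp, transposition, DiffOp.lift_mulOp]
    exact (e a).symm
  | hdd i =>
    have e : extendOp k n (dd k (PolyR k n) i) = dd k (PowR k n) i := DiffOp.lift_dd _ _ _ _ i
    rw [e, tau, tau, transposition, DiffOp.lift_dd, transposition, DiffOp.lift_dd, unop_op,
      unop_op, map_neg, e]
  | hadd P Q hP hQ => simp only [tau, map_add, unop_add] at *; rw [hP, hQ]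
  | hmul P Q hP hQ => simp only [tau, map_mul, unop_mul] at *; rw [hP, hQ]

variable (M : Type v) [AddCommGroup M] [Module (PolyR k n) M]

/-- The completion `M̂ = R̂ ⊗_R M`. -/
def Completion : Type (max u v) := PowR k n ⊗[PolyR k n] M

instance : AddCommGroup (Completion k n M) :=
  inferInstanceAs (AddCommGroup (PowR k n ⊗[PolyR k n] M))

instance : Module (PowR k n) (Completion k n M) :=
  inferInstanceAs (Module (PowR k n) (PowR k n ⊗[PolyR k n] M))

instance : Module k (Completion k n M) :=
  inferInstanceAs (Module k (PowR k n ⊗[PolyR k n] M))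

instance : IsScalarTower k (PowR k n) (Completion k n M) :=
  inferInstanceAs (IsScalarTower k (PowR k n) (PowR k n ⊗[PolyR k n] M))

variable {M}

variable [Module (DiffOp k (PolyR k n)) M] [IsScalarTower (PolyR k n) (DiffOp k (PolyR k n)) M]

theorem mulOp_smul_eq (r : PolyR k n) (m : M) :
    (DiffOp.mulOp r : DiffOp k (PolyR k n)) • m = r • m := by
  have := smul_assoc r (1 : DiffOp k (PolyR k n)) m
  rwa [DiffOp.smul_def, mul_one, one_smul] at this

theorem dd_smul_smul (i : Fin n) (r : PolyR k n) (m : M) :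
    dd k (PolyR k n) i • r • m
      = r • dd k (PolyR k n) i • m + (Coordinates.pd (k := k) i r) • m := by
  rw [← mulOp_smul_eq, ← mul_smul, dd_mulOp, add_smul, mul_smul, mulOp_smul_eq, mulOp_smul_eq]

theorem partialTensor_aux (i : Fin n) (r : PolyR k n) (s : PowR k n) (m : M) :
    (Coordinates.pd (k := k) i (r • s)) ⊗ₜ[PolyR k n] m
        + (r • s) ⊗ₜ[PolyR k n] (dd k (PolyR k n) i • m)
      = (Coordinates.pd (k := k) i s) ⊗ₜ[PolyR k n] (r • m)
        + s ⊗ₜ[PolyR k n] (dd k (PolyR k n) i • r • m) := by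
  have e : Coordinates.pd (k := k) i (r • s)
      = r • Coordinates.pd (k := k) i s + (Coordinates.pd (k := k) i r) • s := by
    rw [Algebra.smul_def r, Algebra.smul_def r, Algebra.smul_def _ s, ← polyToPow_eq_algebraMap,
      Derivation.leibniz, pd_polyToPow, smul_eq_mul, smul_eq_mul,
      polyToPow_eq_algebraMap, polyToPow_eq_algebraMap, mul_comm s]
  rw [e, dd_smul_smul, TensorProduct.tmul_add, TensorProduct.add_tmul, TensorProduct.smul_tmul,
    TensorProduct.smul_tmul, TensorProduct.smul_tmul]
  abel

/-- The additive map `s ⊗ m ↦ ∂_i(s) ⊗ m + s ⊗ ∂_i m` -/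
def partialTensorHom (i : Fin n) :
    PowR k n ⊗[PolyR k n] M →+ PowR k n ⊗[PolyR k n] M :=
  TensorProduct.liftAddHom
    (AddMonoidHom.mk' (fun s : PowR k n => AddMonoidHom.mk' (fun m : M =>
        (Coordinates.pd (k := k) i s) ⊗ₜ[PolyR k n] m
          + s ⊗ₜ[PolyR k n] (dd k (PolyR k n) i • m)) (fun m m' => by
        simp only [smul_add, TensorProduct.tmul_add]; abel))
      (fun s s' => by
        ext m
        simp only [map_add, TensorProduct.add_tmul, AddMonoidHom.mk'_apply,
          AddMonoidHom.add_apply]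
        abel))
    (fun r s m => partialTensor_aux k n i r s m)

theorem partialTensorHom_tmul (i : Fin n) (s : PowR k n) (m : M) :
    partialTensorHom k n i (s ⊗ₜ[PolyR k n] m) = (Coordinates.pd (k := k) i s) ⊗ₜ[PolyR k n] m
      + s ⊗ₜ[PolyR k n] (dd k (PolyR k n) i • m) := rfl

theorem partialTensorHom_leibniz (i : Fin n) (s : PowR k n) (t : PowR k n ⊗[PolyR k n] M) :
    partialTensorHom k n i (s • t)
      = s • partialTensorHom k n i t + (Coordinates.pd (k := k) i s) • t := by
  induction t using TensorProduct.induction_on with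
  | zero => simp
  | add a b ha hb => rw [smul_add, map_add, ha, hb, map_add, smul_add, smul_add]; abel
  | tmul s' m =>
    rw [TensorProduct.smul_tmul', partialTensorHom_tmul, partialTensorHom_tmul, smul_add,
      smul_eq_mul, Derivation.leibniz, TensorProduct.add_tmul, TensorProduct.smul_tmul',
      TensorProduct.smul_tmul', TensorProduct.smul_tmul', smul_eq_mul, smul_eq_mul, smul_eq_mul,
      smul_eq_mul, mul_comm s' (Coordinates.pd (k := k) i s)]
    abel

/-- The action of `∂_i` on `M̂`: `∂_i (s ⊗ m) = ∂_i(s) ⊗ m + s ⊗ ∂_i m`. -/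
def partialTensor (i : Fin n) : Module.End k (PowR k n ⊗[PolyR k n] M) where
  toFun := partialTensorHom k n i
  map_add' := map_add _
  map_smul' c t := by
    have h := partialTensorHom_leibniz k n i (algebraMap k _ c) t
    rwa [Derivation.map_algebraMap, zero_smul, add_zero, algebraMap_smul, algebraMap_smul] at h

theorem partialTensor_commute (i j : Fin n) :
    Commute (partialTensor k n i : Module.End k (PowR k n ⊗[PolyR k n] M))
      (partialTensor k n j) := by
  refine LinearMap.ext fun t => ?_
  show partialTensorHom k n i (partialTensorHom k n j t)
    = partialTensorHom k n j (partialTensorHom k n i t)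
  induction t using TensorProduct.induction_on with
  | zero => simp
  | add a b ha hb => rw [map_add, map_add, map_add, map_add, ha, hb]
  | tmul s m =>
    simp only [partialTensorHom_tmul, map_add]
    rw [Coordinates.pd_comm i j, ← mul_smul, ← mul_smul, (dd_comm i j).eq]
    abel

variable (M) in
/-- The action of `𝒟̂` on `M̂ = R̂ ⊗_R M`: it extends the action of `R̂`, and `∂_i` acts by
`partialTensor`. -/
def completionAction : DiffOp k (PowR k n) →ₐ[k] Module.End k (PowR k n ⊗[PolyR k n] M) :=
  DiffOp.lift (Algebra.lsmul k k (PowR k n ⊗[PolyR k n] M)) (partialTensor k n)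
    (partialTensor_commute k n) fun i s =>
      LinearMap.ext fun t => partialTensorHom_leibniz k n i s t

instance : Module (DiffOp k (PowR k n)) (Completion k n M) :=
  Module.compHom (PowR k n ⊗[PolyR k n] M) (completionAction k n M).toRingHom

instance : IsScalarTower k (DiffOp k (PowR k n)) (Completion k n M) :=
  ⟨fun c P t => by
    show completionAction k n M (c • P) t = c • completionAction k n M P t
    rw [map_smul]; rfl⟩

/-- The map `κ : M → M̂`, `κ(m) = 1 ⊗ m`. -/
def kappa (m : M) : Completion k n M := (1 : PowR k n) ⊗ₜ[PolyR k n] m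

theorem kappa_add (m m' : M) : kappa k n (m + m') = kappa k n m + kappa k n m' :=
  TensorProduct.tmul_add _ _ _

/-- `κ` is `𝒟`-linear. -/
theorem kappa_smul (δ : DiffOp k (PolyR k n)) (m : M) :
    kappa k n (δ • m) = extendOp k n δ • kappa k n m := by
  show kappa k n (δ • m) = completionAction k n M (extendOp k n δ) (kappa k n m)
  induction δ using DiffOp.gen_induction generalizing m with
  | hA a =>
    rw [extendOp, DiffOp.lift_mulOp, completionAction, AlgHom.comp_apply, DiffOp.lift_mulOp,
      mulOp_smul_eq]
    show (1 : PowR k n) ⊗ₜ[PolyR k n] (a • m) = polyToPow k n a • ((1 : PowR k n) ⊗ₜ m)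
    rw [TensorProduct.smul_tmul', polyToPow_eq_algebraMap, algebraMap_smul,
      TensorProduct.smul_tmul]
  | hdd i =>
    rw [extendOp, DiffOp.lift_dd, completionAction, DiffOp.lift_dd]
    show _ = partialTensorHom k n i ((1 : PowR k n) ⊗ₜ[PolyR k n] m)
    rw [partialTensorHom_tmul, Derivation.map_one_eq_zero, TensorProduct.zero_tmul, zero_add]
    rfl
  | hadd P Q hP hQ => rw [add_smul, kappa_add, hP, hQ, map_add, map_add]; rfl
  | hmul P Q hP hQ => rw [mul_smul, hP, hQ, map_mul, map_mul]; rfl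

end Completion

/-! ### Subquotients -/

section SubQuot

variable {k : Type u} [Field k] {Y : Type v} [AddCommGroup Y] [Module k Y]
  {Y' : Type w} [AddCommGroup Y'] [Module k Y']

/-- The quotient of the cycles `Z` by the boundaries `B`. -/
abbrev SubQuot (Z B : Submodule k Y) : Type v := Z ⧸ B.submoduleOf Z

/-- The map induced by `f` on subquotients. -/
def SubQuot.map {Z B : Submodule k Y} {Z' B' : Submodule k Y'} (f : Y →ₗ[k] Y')
    (hZ : ∀ y ∈ Z, f y ∈ Z') (hB : ∀ y ∈ B, f y ∈ B') : SubQuot Z B →ₗ[k] SubQuot Z' B' :=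
  Submodule.mapQ _ _ (f.restrict hZ) fun z hz => hB z.1 hz

end SubQuot

/-! ### The de Rham complex -/

/-- `Ω^i(N)`: one copy of `N` for each `j_1 < ⋯ < j_i`, i.e. for each `i`-element subset `s` of
`{1, …, n}`; the value of `ω` at `s` is the coefficient of `dx_{j_1} ∧ ⋯ ∧ dx_{j_i}`. -/
abbrev DRForm (n i : ℕ) (N : Type w) : Type w := {s : Finset (Fin n) // s.card = i} → N

section DeRham

variable (k : Type u) [Field k] (A : Type v) [CommRing A] [Algebra k A] {n : ℕ}
  [Coordinates k A n] (N : Type w) [AddCommGroup N] [Module k N] [Module (DiffOp k A) N]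
  [IsScalarTower k (DiffOp k A) N]

/-- The differential `d^i : Ω^i(N) → Ω^{i+1}(N)`. The coefficient of `dω` at `t` is the sum over
`s ∈ t` of `± ∂_s` applied to the coefficient of `ω` at `t \ {s}`, where the sign is that of
`dx_s ∧ dx_{t \ {s}} = ± dx_t`. -/
def dRham (i : ℕ) : DRForm n i N →ₗ[k] DRForm n (i + 1) N where
  toFun ω t := ∑ s : {s // s ∈ t.1}, (-1 : ℤ) ^ (t.1.filter (· < s.1)).card •
    dd k A s.1 • ω ⟨t.1.erase s.1, by rw [Finset.card_erase_of_mem s.2, t.2]; rfl⟩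
  map_add' ω η := by
    ext t
    simp only [Pi.add_apply, smul_add, Finset.sum_add_distrib]
  map_smul' c ω := by
    ext t
    simp only [Pi.smul_apply, RingHom.id_apply, Finset.smul_sum]
    refine Finset.sum_congr rfl fun s _ => ?_
    rw [smul_comm (dd k A s.1) c, smul_comm _ c]

/-- The coboundaries in `Ω^i(N)`. -/
def dRhamBoundaries : (i : ℕ) → Submodule k (DRForm n i N)
  | 0 => ⊥
  | i + 1 => LinearMap.range (dRham k A N i)

/-- The de Rham cohomology space `H^i_dR(N)`. -/
abbrev HdR (i : ℕ) : Type w := SubQuot (LinearMap.ker (dRham k A N i)) (dRhamBoundaries k A N i)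

end DeRham

/-! ### Tensor products over noncommutative rings -/

section BalTensor

variable (k : Type u) [Field k] (D : Type v) [Ring D] [Algebra k D]
  (X : Type*) [AddCommGroup X] [Module k X] [Module Dᵐᵒᵖ X]

/-- The relations `xδ ⊗ y = x ⊗ δy`. -/
def balancedRel (N : Type*) [AddCommGroup N] [Module k N] [Module D N] :
    Submodule k (X ⊗[k] N) :=
  Submodule.span k {t | ∃ (x : X) (δ : D) (y : N), t = (op δ • x) ⊗ₜ[k] y - x ⊗ₜ[k] (δ • y)}

/-- The `k`-space `X ⊗_D N` for a right `D`-module `X` and a left `D`-module `N` over a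
`k`-algebra `D`. -/
abbrev BalTensor (N : Type*) [AddCommGroup N] [Module k N] [Module D N] : Type _ :=
  (X ⊗[k] N) ⧸ balancedRel k D X N

variable {k D X}

/-- The class of `x ⊗ y` in `X ⊗_D N`. -/
def BalTensor.tmul {N : Type*} [AddCommGroup N] [Module k N] [Module D N] (x : X) (y : N) :
    BalTensor k D X N := Submodule.Quotient.mk (x ⊗ₜ[k] y)

/-- The map `X ⊗_D N → X' ⊗_{D'} N'` induced by `ψ : X → X'` and `g : N → N'` that are compatible
with a map of `k`-algebras `f : D → D'`. -/
def BalTensor.map {D' : Type*} [Ring D'] [Algebra k D'] (f : D →ₐ[k] D')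
    {X' : Type*} [AddCommGroup X'] [Module k X'] [Module D'ᵐᵒᵖ X']
    {N : Type*} [AddCommGroup N] [Module k N] [Module D N]
    {N' : Type*} [AddCommGroup N'] [Module k N'] [Module D' N']
    (ψ : X →ₗ[k] X') (hψ : ∀ (δ : D) (x : X), ψ (op δ • x) = op (f δ) • ψ x)
    (g : N →ₗ[k] N') (hg : ∀ (δ : D) (y : N), g (δ • y) = f δ • g y) :
    BalTensor k D X N →ₗ[k] BalTensor k D' X' N' :=
  Submodule.mapQ _ _ (TensorProduct.map ψ g) <| Submodule.span_le.mpr <| by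
    rintro _ ⟨x, δ, y, rfl⟩
    refine Submodule.subset_span ⟨ψ x, f δ, g y, ?_⟩
    rw [map_sub, TensorProduct.map_tmul, TensorProduct.map_tmul, hψ, hg]

theorem BalTensor.map_tmul {D' : Type*} [Ring D'] [Algebra k D'] (f : D →ₐ[k] D')
    {X' : Type*} [AddCommGroup X'] [Module k X'] [Module D'ᵐᵒᵖ X']
    {N : Type*} [AddCommGroup N] [Module k N] [Module D N]
    {N' : Type*} [AddCommGroup N'] [Module k N'] [Module D' N']
    (ψ : X →ₗ[k] X') (hψ : ∀ (δ : D) (x : X), ψ (op δ • x) = op (f δ) • ψ x)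
    (g : N →ₗ[k] N') (hg : ∀ (δ : D) (y : N), g (δ • y) = f δ • g y) (x : X) (y : N) :
    BalTensor.map f ψ hψ g hg (BalTensor.tmul x y) = BalTensor.tmul (ψ x) (g y) := rfl

theorem BalTensor.hom_ext {N : Type*} [AddCommGroup N] [Module k N] [Module D N]
    {P : Type*} [AddCommGroup P] [Module k P] {f g : BalTensor k D X N →ₗ[k] P}
    (h : ∀ x y, f (BalTensor.tmul x y) = g (BalTensor.tmul x y)) : f = g :=
  Submodule.linearMap_qext _ (TensorProduct.ext' h)

end BalTensor

/-! ### The canonical free resolution -/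

section FreeResolution

/-- The canonical map from the free module on the set `N` to `N`. -/
abbrev freeCover (D : Type u) [Ring D] (N : Type v) [AddCommGroup N] [Module D N] :
    (N →₀ D) →ₗ[D] N := Finsupp.linearCombination D id

/-- The modules `S_0 = N` and `S_{j+1} = ker(D^{(S_j)} → S_j)`. -/
def syz (D : Type u) [Ring D] (N : Type v) [AddCommGroup N] [Module D N] :
    ℕ → ModuleCat.{max u v} D
  | 0 => ModuleCat.of D (ULift.{u} N)
  | j + 1 => ModuleCat.of D (LinearMap.ker (freeCover D (syz D N j)))

variable (D : Type u) [Ring D] (N : Type v) [AddCommGroup N] [Module D N]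

/-- The term `F_j = D^{(S_j)}` of the canonical free resolution of `N`. -/
abbrev freeRes (j : ℕ) : Type (max u v) := syz D N j →₀ D

/-- The inclusion `S_{j+1} → F_j`. -/
def syzIncl (j : ℕ) : syz D N (j + 1) →ₗ[D] freeRes D N j :=
  (LinearMap.ker (freeCover D (syz D N j))).subtype

/-- The identification `S_0 = N`. -/
def syzZero : syz D N 0 →ₗ[D] N := (ULift.moduleEquiv : ULift.{u} N ≃ₗ[D] N).toLinearMap

/-- The differential `F_{j+1} → S_{j+1} ⊆ F_j`. -/
def freeRes.d (j : ℕ) : freeRes D N (j + 1) →ₗ[D] freeRes D N j :=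
  syzIncl D N j ∘ₗ freeCover D (syz D N (j + 1))

/-- The augmentation `F_0 → N`. -/
def freeRes.aug : freeRes D N 0 →ₗ[D] N := syzZero D N ∘ₗ freeCover D (syz D N 0)

theorem freeCover_surjective : Function.Surjective (freeCover D N) :=
  fun y => ⟨Finsupp.single y 1, by simp [freeCover]⟩

theorem ker_syzZero : LinearMap.ker (syzZero D N) = ⊥ :=
  LinearMap.ker_eq_bot_of_injective (f := syzZero D N) ULift.down_injective

theorem ker_syzIncl (j : ℕ) : LinearMap.ker (syzIncl D N j) = ⊥ :=
  LinearMap.ker_eq_bot_of_injective (f := syzIncl D N j) Subtype.val_injective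

theorem range_syzIncl (j : ℕ) :
    LinearMap.range (syzIncl D N j) = LinearMap.ker (freeCover D (syz D N j)) :=
  Submodule.range_subtype _

/-- `⋯ → F_1 → F_0 → N → 0` is exact at `N`. -/
theorem freeRes.aug_surjective : Function.Surjective (freeRes.aug D N) :=
  fun y => (freeCover_surjective D (syz D N 0) (ULift.up y)).imp fun _ h => congrArg ULift.down h

theorem freeRes.range_d (j : ℕ) :
    LinearMap.range (freeRes.d D N j) = LinearMap.ker (freeCover D (syz D N j)) := by
  rw [freeRes.d, LinearMap.range_comp,
    LinearMap.range_eq_top.mpr (freeCover_surjective D (syz D N (j + 1))), Submodule.map_top,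
    range_syzIncl]

/-- `⋯ → F_1 → F_0 → N → 0` is exact at `F_0`. -/
theorem freeRes.exact_zero :
    LinearMap.range (freeRes.d D N 0) = LinearMap.ker (freeRes.aug D N) := by
  rw [freeRes.range_d, freeRes.aug, LinearMap.ker_comp, ker_syzZero]
  rfl

/-- `⋯ → F_1 → F_0 → N → 0` is exact at `F_{j+1}`. -/
theorem freeRes.exact_succ (j : ℕ) :
    LinearMap.range (freeRes.d D N (j + 1)) = LinearMap.ker (freeRes.d D N j) := by
  rw [freeRes.range_d, freeRes.d, LinearMap.ker_comp, ker_syzIncl]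
  rfl

variable {D N} {D' : Type w} [Ring D'] {N' : Type*} [AddCommGroup N'] [Module D' N']

/-- The map of free modules induced by a ring map and a map of bases. -/
def freeMap (f : D →+* D') {S T : Type*} (g : S → T) : (S →₀ D) →ₛₗ[f] (T →₀ D') where
  toFun v := (v.mapRange f (map_zero f)).mapDomain g
  map_add' v v' := by
    rw [Finsupp.mapRange_add (map_add f), Finsupp.mapDomain_add]
  map_smul' a v := by
    rw [← Finsupp.mapDomain_smul]
    congr 1
    ext s
    simp

theorem freeMap_single (f : D →+* D') {S T : Type*} (g : S → T) (s : S) (a : D) :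
    freeMap f g (Finsupp.single s a) = Finsupp.single (g s) (f a) := by
  simp [freeMap]

theorem freeCover_freeMap (f : D →+* D') (φ : N →ₛₗ[f] N') (v : N →₀ D) :
    freeCover D' N' (freeMap f φ v) = φ (freeCover D N v) := by
  induction v using Finsupp.induction_linear with
  | zero => simp
  | add v v' h h' => rw [map_add, map_add, h, h', map_add, map_add]
  | single s a => rw [freeMap_single]; simp [freeCover]

/-- The maps `S_j(N) → S_j(N')` induced by a map `N → N'` over a ring map `D → D'`. -/
def syzMap (f : D →+* D') (φ : N →ₛₗ[f] N') : (j : ℕ) → syz D N j →ₛₗ[f] syz D' N' j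
  | 0 =>
    { toFun := fun y => ULift.up (φ y.down)
      map_add' := fun y y' => congrArg ULift.up (map_add φ y.down y'.down)
      map_smul' := fun a y => congrArg ULift.up (map_smulₛₗ φ a y.down) }
  | j + 1 =>
    { toFun := fun v => ⟨freeMap f (syzMap f φ j) v.1, by
        rw [LinearMap.mem_ker, freeCover_freeMap, LinearMap.mem_ker.mp v.2, map_zero]⟩
      map_add' := fun v v' => Subtype.ext (map_add (freeMap f (syzMap f φ j)) v.1 v'.1)
      map_smul' := fun a v => Subtype.ext (map_smulₛₗ (freeMap f (syzMap f φ j)) a v.1) }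

/-- The map of free resolutions induced by a map `N → N'` over a ring map `D → D'`. -/
def freeResMap (f : D →+* D') (φ : N →ₛₗ[f] N') (j : ℕ) :
    freeRes D N j →ₛₗ[f] freeRes D' N' j := freeMap f (syzMap f φ j)

theorem freeResMap_d (f : D →+* D') (φ : N →ₛₗ[f] N') (j : ℕ) (v : freeRes D N (j + 1)) :
    freeResMap f φ j (freeRes.d D N j v) = freeRes.d D' N' j (freeResMap f φ (j + 1) v) := by
  have h := freeCover_freeMap f (syzMap f φ (j + 1)) v
  show _ = (freeCover D' (syz D' N' (j + 1)) (freeMap f (syzMap f φ (j + 1)) v)).1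
  rw [h]
  rfl

theorem freeResMap_aug (f : D →+* D') (φ : N →ₛₗ[f] N') (v : freeRes D N 0) :
    freeRes.aug D' N' (freeResMap f φ 0 v) = φ (freeRes.aug D N v) :=
  congrArg ULift.down (freeCover_freeMap f (syzMap f φ 0) v)

end FreeResolution

/-! ### Tor -/

section Tor

variable (k : Type u) [Field k] (D : Type v) [Ring D] [Algebra k D]
  (X : Type*) [AddCommGroup X] [Module k X] [Module Dᵐᵒᵖ X]
  (N : Type w) [AddCommGroup N] [Module D N]

/-- The differential `X ⊗_D F_{j+1} → X ⊗_D F_j`. -/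
def torD (j : ℕ) : BalTensor k D X (freeRes D N (j + 1)) →ₗ[k] BalTensor k D X (freeRes D N j) :=
  BalTensor.map (AlgHom.id k D) LinearMap.id (fun _ _ => rfl)
    ((freeRes.d D N j).restrictScalars k) (fun δ y => map_smul (freeRes.d D N j) δ y)

/-- The cycles in `X ⊗_D F_j`. -/
def torCycles : (j : ℕ) → Submodule k (BalTensor k D X (freeRes D N j))
  | 0 => ⊤
  | j + 1 => LinearMap.ker (torD k D X N j)

/-- `Tor_j^D(X, N)`, the `j`-th homology of `X ⊗_D F_•` for the canonical free resolution `F_•` of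
the left `D`-module `N`. -/
abbrev TorSpace (j : ℕ) : Type _ :=
  SubQuot (torCycles k D X N j) (LinearMap.range (torD k D X N j))

variable {k D X N} {D' : Type*} [Ring D'] [Algebra k D']
  {X' : Type*} [AddCommGroup X'] [Module k X'] [Module D'ᵐᵒᵖ X']
  {N' : Type*} [AddCommGroup N'] [Module D' N']

/-- The map `X ⊗_D F_j(N) → X' ⊗_{D'} F_j(N')`. -/
def torChainMap (f : D →ₐ[k] D') (ψ : X →ₗ[k] X')
    (hψ : ∀ (δ : D) (x : X), ψ (op δ • x) = op (f δ) • ψ x) (φ : N →ₛₗ[f.toRingHom] N') (j : ℕ) :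
    BalTensor k D X (freeRes D N j) →ₗ[k] BalTensor k D' X' (freeRes D' N' j) :=
  BalTensor.map f ψ hψ
    { toFun := freeResMap f.toRingHom φ j
      map_add' := map_add _
      map_smul' := fun c v => by
        have h := map_smulₛₗ (freeResMap f.toRingHom φ j) (algebraMap k D c) v
        rw [algebraMap_smul] at h
        rw [h]
        show f (algebraMap k D c) • _ = _
        rw [f.commutes, algebraMap_smul]
        rfl }
    (fun δ y => map_smulₛₗ (freeResMap f.toRingHom φ j) δ y)

theorem torChainMap_torD (f : D →ₐ[k] D') (ψ : X →ₗ[k] X')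
    (hψ : ∀ (δ : D) (x : X), ψ (op δ • x) = op (f δ) • ψ x) (φ : N →ₛₗ[f.toRingHom] N') (j : ℕ)
    (t : BalTensor k D X (freeRes D N (j + 1))) :
    torChainMap f ψ hψ φ j (torD k D X N j t)
      = torD k D' X' N' j (torChainMap f ψ hψ φ (j + 1) t) := by
  suffices h : torChainMap f ψ hψ φ j ∘ₗ torD k D X N j
      = torD k D' X' N' j ∘ₗ torChainMap f ψ hψ φ (j + 1) from LinearMap.congr_fun h t
  refine BalTensor.hom_ext fun x y => ?_
  exact congrArg (BalTensor.tmul (ψ x)) (freeResMap_d f.toRingHom φ j y)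

/-- The map `Tor_j^D(X, N) → Tor_j^{D'}(X', N')` induced by `ψ : X → X'` and `φ : N → N'` over a
map of `k`-algebras `f : D → D'`. -/
def torMap (f : D →ₐ[k] D') (ψ : X →ₗ[k] X')
    (hψ : ∀ (δ : D) (x : X), ψ (op δ • x) = op (f δ) • ψ x) (φ : N →ₛₗ[f.toRingHom] N') (j : ℕ) :
    TorSpace k D X N j →ₗ[k] TorSpace k D' X' N' j :=
  SubQuot.map (torChainMap f ψ hψ φ j)
    (by
      cases j with
      | zero => exact fun _ _ => Submodule.mem_top
      | succ j =>
        intro t ht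
        have h0 : torD k D X N j t = 0 := ht
        show torD k D' X' N' j _ = 0
        rw [← torChainMap_torD, h0, map_zero])
    (by
      rintro _ ⟨t, rfl⟩
      exact ⟨_, (torChainMap_torD f ψ hψ φ j t).symm⟩)

end Tor

/-! ### The comparison of de Rham cohomology with Tor -/

section Comparison

variable (k : Type u) [Field k] [CharZero k] (A : Type v) [CommRing A] [Algebra k A] {n : ℕ}
  [Coordinates k A n] (N : Type w) [AddCommGroup N] [Module k N] [Module (DiffOp k A) N]
  [IsScalarTower k (DiffOp k A) N]

/-- Let `F_• → N` be the canonical free resolution. A family of `w_p ∈ Ω^{i+p}(F_p)` is a cycle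
of degree `j = n - i` in the total complex of the double complex
`Ω^•(𝒟) ⊗_𝒟 F_• = Ω^•(F_•)`. (`w_p = 0` for `p > j`, since then `Ω^{i+p} = 0`.) -/
def IsTotalCycle (i j : ℕ) (w : ∀ p, DRForm n (i + p) (freeRes (DiffOp k A) N p)) : Prop :=
  ∀ p, dRham k A (freeRes (DiffOp k A) N p) (i + p) (w p)
    = fun t => (-1 : ℤ) ^ (j + p) • freeRes.d (DiffOp k A) N p (w (p + 1) t)

variable {k A N}

/-- The map `e : H^i_dR(N) → Tor_j(A^τ, N)`, with `i + j = n`, is the one given by the two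
augmentations `Ω^•(N) ← Ω^•(F_•) → A^τ ⊗_𝒟 F_•` of the total complex: `e c = y` if and only if
there is a total cycle `w` whose image `aug(w_0)` in `Ω^i(N)` represents `c` and whose image
`1 ⊗ w_j` in `A^τ ⊗_𝒟 F_j` (where `Ω^n(F_j) = F_j dx_1 ∧ ⋯ ∧ dx_n`) represents `y`. -/
def IsComparison {i j : ℕ} (hij : i + j = n)
    (e : HdR k A N i → TorSpace k (DiffOp k A) (Transpose k A A) N j) : Prop :=
  ∀ c y, e c = y ↔ ∃ w, IsTotalCycle k A N i j w ∧
    (∃ z : LinearMap.ker (dRham k A N i),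
      z.1 = (fun s => freeRes.aug (DiffOp k A) N (w 0 s)) ∧ Submodule.Quotient.mk z = c) ∧
    ∃ z : torCycles k (DiffOp k A) (Transpose k A A) N j,
      z.1 = BalTensor.tmul (Transpose.of k A (1 : A))
        (w j ⟨Finset.univ, by rw [Finset.card_univ, Fintype.card_fin, hij]⟩) ∧
      Submodule.Quotient.mk z = y

end Comparison

/-! ### The maps `κ^i` and `ι_j` -/

section CompletionMaps

variable (k : Type u) [Field k] [CharZero k] (n : ℕ) (M : Type v) [AddCommGroup M] [Module k M]
  [Module (PolyR k n) M] [Module (DiffOp k (PolyR k n)) M]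
  [IsScalarTower k (DiffOp k (PolyR k n)) M]
  [IsScalarTower (PolyR k n) (DiffOp k (PolyR k n)) M]

/-- `κ : M → M̂` as a map over `𝒟 → 𝒟̂`. -/
def kappaSemilinear : M →ₛₗ[(extendOp k n).toRingHom] Completion k n M where
  toFun := kappa k n
  map_add' := kappa_add k n
  map_smul' := kappa_smul k n

theorem kappa_smul_field (c : k) (m : M) : kappa k n (c • m) = c • kappa k n m := by
  rw [← algebraMap_smul (DiffOp k (PolyR k n)) c m, kappa_smul, AlgHom.commutes, algebraMap_smul]

/-- `κ` applied to each summand of `Ω^i(M)`. -/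
def kappaForm (i : ℕ) : DRForm n i M →ₗ[k] DRForm n i (Completion k n M) where
  toFun ω s := kappa k n (ω s)
  map_add' ω η := funext fun s => kappa_add k n (ω s) (η s)
  map_smul' c ω := funext fun s => kappa_smul_field k n M c (ω s)

theorem kappaForm_dRham (i : ℕ) (ω : DRForm n i M) :
    kappaForm k n M (i + 1) (dRham k (PolyR k n) M i ω)
      = dRham k (PowR k n) (Completion k n M) i (kappaForm k n M i ω) := by
  funext t
  show kappaSemilinear k n M (∑ s : {s // s ∈ t.1}, _) = ∑ s : {s // s ∈ t.1}, _
  rw [map_sum]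
  refine Finset.sum_congr rfl fun s _ => ?_
  rw [map_zsmul]
  congr 1
  have e : extendOp k n (dd k (PolyR k n) s.1) = dd k (PowR k n) s.1 := DiffOp.lift_dd _ _ _ _ _
  rw [← e]
  exact kappa_smul k n _ _

/-- `κ^i : H^i_dR(M) → H^i_dR(M̂)` -/
def kappaCoh (i : ℕ) :
    HdR k (PolyR k n) M i →ₗ[k] HdR k (PowR k n) (Completion k n M) i :=
  SubQuot.map (kappaForm k n M i)
    (fun ω hω => by
      rw [LinearMap.mem_ker] at hω ⊢
      rw [← kappaForm_dRham, hω, map_zero])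
    (by
      cases i with
      | zero =>
        intro ω hω
        rw [(Submodule.mem_bot k).mp hω, map_zero]
        exact Submodule.zero_mem _
      | succ i =>
        rintro _ ⟨η, rfl⟩
        exact ⟨_, (kappaForm_dRham k n M i η).symm⟩)

/-- The inclusion `R^τ → R̂^τ`. -/
def transposeIncl :
    Transpose k (PolyR k n) (PolyR k n) →ₗ[k] Transpose k (PowR k n) (PowR k n) :=
  (Transpose.of k (PowR k n)).toLinearMap ∘ₗ (polyToPow k n).toLinearMap ∘ₗ
    (Transpose.of k (PolyR k n)).symm.toLinearMap

theorem transposeIncl_smul (δ : DiffOp k (PolyR k n)) (r : Transpose k (PolyR k n) (PolyR k n)) :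
    transposeIncl k n (op δ • r) = op (extendOp k n δ) • transposeIncl k n r := by
  show polyToPow k n (tau k (PolyR k n) δ • (Transpose.of k (PolyR k n)).symm r)
    = tau k (PowR k n) (extendOp k n δ)
      • polyToPow k n ((Transpose.of k (PolyR k n)).symm r)
  rw [tau_extendOp, extendOp_smul_polyToPow]

/-- `ι_j : Tor_j^𝒟(R^τ, M) → Tor_j^𝒟̂(R̂^τ, M̂)`, induced by `R^τ → R̂^τ` and `κ : M → M̂` -/
def iota (j : ℕ) :
    TorSpace k (DiffOp k (PolyR k n)) (Transpose k (PolyR k n) (PolyR k n)) M j →ₗ[k]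
      TorSpace k (DiffOp k (PowR k n)) (Transpose k (PowR k n) (PowR k n)) (Completion k n M) j :=
  torMap (extendOp k n) (transposeIncl k n) (transposeIncl_smul k n) (kappaSemilinear k n M) j

end CompletionMaps

end

/-!
Let `A` be `k[x_1, …, x_n]` or `k[[x_1, …, x_n]]`, with its ring `𝒟` of differential operators, and
consider the double complex `Ω^•(F_•)` of the canonical free resolution `F_• → N` of a `𝒟`-module
`N`.

Along the resolution the double complex is exact, with augmentation `Ω^•(N)`. Along `Ω^•` it is
exact below the top degree: on a free module `𝒟^(S)` put `X_s = [·, x_s]`, so that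
`[X_r, ∂_s] = δ_{rs}`. With `ι_s` the contraction with `∂_s`, the operator `h = ∑ X_s ι_s`
satisfies `dh + hd = E + (n - q)` on `q`-forms, where `E = ∑ ∂_s X_s` is diagonalizable with
eigenvalues in `ℕ` (it measures the order of a differential operator). In characteristic zero
`E + (n - q)` is therefore invertible for `q < n`. In the top degree the cokernel `N / ∑ ∂_s N` is
`A^τ ⊗_𝒟 N`, by integration by parts.

Hence a class in either `H^i_dR(N)` or `Tor_{n-i}(A^τ, N)` lifts along the staircase to a total
cycle `w = (w_p)`. The condition that `w_p` be a sum of boundaries for the two differentials passes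
from `p` to `p + 1` and back, so the two maps from total cycles have the same kernel. The map `κ`
preserves total cycles, which gives the commutative square.
-/

noncomputable section

universe u v w

section LinearAlgebra

theorem isUnit_sub_algebraMap_of_iSup_eigenspace_eq_top {K V ι : Type*} [Field K]
    [AddCommGroup V] [Module K V] {f : Module.End K V} {μ : ι → K}
    (hf : ⨆ i, f.eigenspace (μ i) = ⊤) {c : K} (hc : ∀ i, μ i ≠ c) :
    IsUnit (f - algebraMap K (Module.End K V) c) := by
  rw [Module.End.isUnit_iff, Function.Bijective, ← LinearMap.ker_eq_bot, ← LinearMap.range_eq_top]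
  constructor
  · have hdisj : Disjoint (f.eigenspace c) (⨆ i, f.eigenspace (μ i)) :=
      (f.eigenspaces_iSupIndep c).mono_right (iSup_le fun i => le_iSup₂_of_le (μ i) (hc i) le_rfl)
    rw [hf, disjoint_top, Module.End.eigenspace_def] at hdisj
    exact hdisj
  · refine top_le_iff.mp (hf.ge.trans (iSup_le fun i v hv => ⟨(μ i - c)⁻¹ • v, ?_⟩))
    have hfv : (f - algebraMap K (Module.End K V) c) v = (μ i - c) • v := by
      rw [LinearMap.sub_apply, Module.End.mem_eigenspace_iff.mp hv, Module.algebraMap_end_apply,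
        sub_smul]
    rw [map_smul, hfv, inv_smul_smul₀ (sub_ne_zero.mpr (hc i))]

theorem exists_linearEquiv_of_surjective_of_ker_eq {R Z U V : Type*} [Ring R]
    [AddCommGroup Z] [Module R Z] [AddCommGroup U] [Module R U] [AddCommGroup V] [Module R V]
    {f : Z →ₗ[R] U} {g : Z →ₗ[R] V} (hf : Function.Surjective f) (hg : Function.Surjective g)
    (h : LinearMap.ker f = LinearMap.ker g) :
    ∃ e : U ≃ₗ[R] V, ∀ u v, e u = v ↔ ∃ z, f z = u ∧ g z = v := by
  let e : U ≃ₗ[R] V := (f.quotKerEquivOfSurjective hf).symm.trans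
    ((Submodule.quotEquivOfEq _ _ h).trans (g.quotKerEquivOfSurjective hg))
  have he (z : Z) : e (f z) = g z := by
    simp only [e, LinearEquiv.trans_apply]
    rw [← f.quotKerEquivOfSurjective_apply_mk hf, LinearEquiv.symm_apply_apply,
      Submodule.quotEquivOfEq_mk, g.quotKerEquivOfSurjective_apply_mk hg]
  refine ⟨e, fun u v => ⟨?_, ?_⟩⟩
  · rintro rfl
    obtain ⟨z, rfl⟩ := hf u
    exact ⟨z, rfl, (he z).symm⟩
  · rintro ⟨z, rfl, rfl⟩
    exact he z

end LinearAlgebra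

section ExteriorAlgebra

variable {ι : Type*} [LinearOrder ι] {N : Type*} [AddCommGroup N]

/-- The sign `ε` in `dx_s ∧ dx_{t \ {s}} = ε dx_t`, for `s ∈ t`. -/
def wedgeSign (s : ι) (t : Finset ι) : ℤ := (-1) ^ (t.filter (· < s)).card

theorem wedgeSign_mul_self (s : ι) (t : Finset ι) : wedgeSign s t * wedgeSign s t = 1 := by
  rw [wedgeSign, ← mul_pow, neg_one_mul, neg_neg, one_pow]

theorem wedgeSign_erase_of_lt {r s : ι} (h : r < s) {t : Finset ι} (hr : r ∈ t) :
    wedgeSign s (t.erase r) = -wedgeSign s t := by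
  have hmem : r ∈ t.filter (· < s) := Finset.mem_filter.mpr ⟨hr, h⟩
  rw [wedgeSign, wedgeSign, Finset.filter_erase, ← Finset.card_erase_add_one hmem, pow_succ,
    mul_neg_one, neg_neg]

theorem wedgeSign_erase_of_not_lt {r s : ι} (h : ¬ r < s) (t : Finset ι) :
    wedgeSign s (t.erase r) = wedgeSign s t := by
  have hmem : r ∉ t.filter (· < s) := fun hr => h (Finset.mem_filter.mp hr).2
  rw [wedgeSign, wedgeSign, Finset.filter_erase, Finset.erase_eq_of_notMem hmem]

theorem wedgeSign_erase_mul_wedgeSign {r s : ι} (hrs : r ≠ s) {t : Finset ι} (hr : r ∈ t)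
    (hs : s ∈ t) :
    wedgeSign s (t.erase r) * wedgeSign r t = -(wedgeSign r (t.erase s) * wedgeSign s t) := by
  rcases hrs.lt_or_gt with h | h
  · rw [wedgeSign_erase_of_lt h hr, wedgeSign_erase_of_not_lt h.not_gt]
    ring
  · rw [wedgeSign_erase_of_lt h hs, wedgeSign_erase_of_not_lt h.not_gt]
    ring

theorem wedgeSign_erase_mul_wedgeSign_erase {r s : ι} (hrs : r ≠ s) {t : Finset ι} (hr : r ∈ t)
    (hs : s ∈ t) :
    wedgeSign s (t.erase r) * wedgeSign r (t.erase s) = -(wedgeSign s t * wedgeSign r t) := by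
  rcases hrs.lt_or_gt with h | h
  · rw [wedgeSign_erase_of_lt h hr, wedgeSign_erase_of_not_lt h.not_gt, neg_mul]
  · rw [wedgeSign_erase_of_lt h hs, wedgeSign_erase_of_not_lt h.not_gt, mul_neg]

variable {R : Type*} [Ring R] [Module R N]

variable (R) in
/-- Left multiplication by `dx_s` on the exterior algebra with coefficients in `N`. An element is
the family of its coefficients, that at `t` being the coefficient of `dx_t`. -/
def wedge (s : ι) : (Finset ι → N) →ₗ[R] (Finset ι → N) where
  toFun g t := if s ∈ t then wedgeSign s t • g (t.erase s) else 0
  map_add' g g' := by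
    ext t
    by_cases hs : s ∈ t <;> simp [hs]
  map_smul' c g := by
    ext t
    by_cases hs : s ∈ t <;> simp [hs, smul_comm c]

variable (R) in
/-- Contraction with the vector field dual to `dx_s`. -/
def contract (s : ι) : (Finset ι → N) →ₗ[R] (Finset ι → N) where
  toFun g t := if s ∈ t then 0 else wedgeSign s t • g (insert s t)
  map_add' g g' := by
    ext t
    by_cases hs : s ∈ t <;> simp [hs]
  map_smul' c g := by
    ext t
    by_cases hs : s ∈ t <;> simp [hs, smul_comm c]

theorem wedge_apply (s : ι) (g : Finset ι → N) (t : Finset ι) :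
    wedge R s g t = if s ∈ t then wedgeSign s t • g (t.erase s) else 0 := rfl

theorem contract_apply (s : ι) (g : Finset ι → N) (t : Finset ι) :
    contract R s g t = if s ∈ t then 0 else wedgeSign s t • g (insert s t) := rfl

theorem wedge_wedge (r s : ι) (g : Finset ι → N) :
    wedge R r (wedge R s g) = -wedge R s (wedge R r g) := by
  ext t
  rw [Pi.neg_apply, wedge_apply, wedge_apply, wedge_apply, wedge_apply]
  rcases eq_or_ne r s with rfl | hrs
  · simp
  by_cases hr : r ∈ t <;> by_cases hs : s ∈ t <;> simp only [hr, hs, Finset.mem_erase, ne_eq,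
    hrs, hrs.symm, not_false_eq_true, true_and, and_false, if_true, if_false, smul_zero,
    neg_zero]
  rw [smul_smul, smul_smul, mul_comm, wedgeSign_erase_mul_wedgeSign hrs hr hs, neg_smul, mul_comm,
    Finset.erase_right_comm]

theorem wedge_contract_self (s : ι) (g : Finset ι → N) (t : Finset ι) :
    wedge R s (contract R s g) t = if s ∈ t then g t else 0 := by
  by_cases hs : s ∈ t
  · simp only [wedge_apply, contract_apply, hs, Finset.notMem_erase, if_true, if_false]
    rw [wedgeSign_erase_of_not_lt (lt_irrefl s), smul_smul, wedgeSign_mul_self, one_smul,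
      Finset.insert_erase hs]
  · simp only [wedge_apply, hs, if_false]

theorem contract_wedge_self (s : ι) (g : Finset ι → N) (t : Finset ι) :
    contract R s (wedge R s g) t = if s ∈ t then 0 else g t := by
  by_cases hs : s ∈ t
  · simp only [contract_apply, hs, if_true]
  · have hsign := wedgeSign_erase_of_not_lt (lt_irrefl s) (insert s t)
    rw [Finset.erase_insert hs] at hsign
    simp only [wedge_apply, contract_apply, hs, Finset.mem_insert_self, if_true, if_false]
    rw [hsign, smul_smul, wedgeSign_mul_self, one_smul, Finset.erase_insert hs]

theorem contract_wedge {r s : ι} (hrs : r ≠ s) (g : Finset ι → N) :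
    contract R r (wedge R s g) = -wedge R s (contract R r g) := by
  ext t
  rw [Pi.neg_apply, contract_apply, wedge_apply, wedge_apply, contract_apply]
  by_cases hr : r ∈ t <;> by_cases hs : s ∈ t <;> simp only [hr, hs, Finset.mem_erase, ne_eq,
    Finset.mem_insert, hrs, hrs.symm, not_false_eq_true, true_and, or_true, and_false,
    if_true, if_false, smul_zero, neg_zero, or_self]
  obtain ⟨u, hru, rfl⟩ : ∃ u, r ∈ u ∧ u.erase r = t :=
    ⟨insert r t, Finset.mem_insert_self r t, Finset.erase_insert hr⟩
  have hsu : s ∈ u := Finset.mem_of_mem_erase hs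
  rw [Finset.insert_erase hru, Finset.erase_right_comm,
    Finset.insert_erase (Finset.mem_erase.mpr ⟨hrs, hru⟩),
    wedgeSign_erase_of_not_lt (lt_irrefl r), wedgeSign_erase_of_not_lt (lt_irrefl r), smul_smul,
    smul_smul, wedgeSign_erase_mul_wedgeSign_erase hrs hru hsu, neg_smul, neg_neg, mul_comm]

theorem wedge_compLeft {N' : Type*} [AddCommGroup N'] [Module R N'] (f : N →ₗ[R] N') (s : ι)
    (g : Finset ι → N) : wedge R s (f.compLeft _ g) = f.compLeft _ (wedge R s g) := by
  ext t
  by_cases hs : s ∈ t <;> simp [wedge_apply, hs]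

theorem contract_compLeft {N' : Type*} [AddCommGroup N'] [Module R N'] (f : N →ₗ[R] N') (s : ι)
    (g : Finset ι → N) : contract R s (f.compLeft _ g) = f.compLeft _ (contract R s g) := by
  ext t
  by_cases hs : s ∈ t <;> simp [contract_apply, hs]

end ExteriorAlgebra

section EulerOperator

variable {ι : Type*} [Fintype ι] {N : Type*} [AddCommGroup N]

/-- The Euler operator `∑ s, ∂_s X_s`. If `X_r` is a commutator with the coordinate `x_r`, so that
`[X_r, ∂_s] = δ_{rs}`, then its eigenvalues measure the order of a differential operator. -/
def eulerOp {R : Type*} [Ring R] [Module R N] (D X : ι → Module.End R N) : Module.End R N :=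
  ∑ s, D s * X s

theorem eulerOp_mul {R : Type*} [Ring R] [Module R N] [DecidableEq ι]
    {D X : ι → Module.End R N} (hD : ∀ r s, Commute (D r) (D s))
    (hX : ∀ r s, X r * D s = D s * X r + if r = s then 1 else 0) (s : ι) :
    eulerOp D X * D s = D s * eulerOp D X + D s := by
  have hterm (r : ι) : D r * X r * D s = D s * (D r * X r) + if r = s then D r else 0 := by
    rw [mul_assoc, hX, mul_add, ← mul_assoc, (hD r s).eq, mul_assoc, mul_ite, mul_one, mul_zero]
  simp only [eulerOp, Finset.sum_mul, Finset.mul_sum, hterm, Finset.sum_add_distrib,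
    Finset.sum_ite_eq', Finset.mem_univ, if_true]

variable {R : Type*} [CommRing R] [Module R N] {D X : ι → Module.End R N}

theorem mem_iSup_eigenspace_eulerOp_of_forall_apply_eq_zero {v : N} (hv : ∀ s, X s v = 0) :
    v ∈ ⨆ m : ℕ, (eulerOp D X).eigenspace (m : R) := by
  refine Submodule.mem_iSup_of_mem 0 (Module.End.mem_eigenspace_iff.mpr ?_)
  simp [eulerOp, hv]

theorem apply_mem_iSup_eigenspace_eulerOp [DecidableEq ι] (hD : ∀ r s, Commute (D r) (D s))
    (hX : ∀ r s, X r * D s = D s * X r + if r = s then 1 else 0) (s : ι) {v : N}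
    (hv : v ∈ ⨆ m : ℕ, (eulerOp D X).eigenspace (m : R)) :
    D s v ∈ ⨆ m : ℕ, (eulerOp D X).eigenspace (m : R) := by
  suffices h : ⨆ m : ℕ, (eulerOp D X).eigenspace (m : R)
      ≤ (⨆ m : ℕ, (eulerOp D X).eigenspace (m : R)).comap (D s) from h hv
  refine iSup_le fun m w hw => Submodule.mem_iSup_of_mem (m + 1) ?_
  rw [Module.End.mem_eigenspace_iff] at hw ⊢
  rw [← Module.End.mul_apply (eulerOp D X), eulerOp_mul hD hX, LinearMap.add_apply,
    Module.End.mul_apply, hw, map_smul, Nat.cast_succ, add_smul, one_smul]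

end EulerOperator

section Koszul

variable {ι : Type*} [LinearOrder ι] [Fintype ι] {R : Type*} [Ring R] {N : Type*}
  [AddCommGroup N] [Module R N]

/-- The differential `∑ s, dx_s ∧ ∂_s` of the Koszul complex of operators `∂_s` on `N`. All degrees
are taken together: an element is the family of all the coefficients of an inhomogeneous form. -/
def koszulDiff (D : ι → Module.End R N) : (Finset ι → N) →ₗ[R] (Finset ι → N) :=
  ∑ s, wedge R s ∘ₗ (D s).compLeft (Finset ι)

/-- The operator `∑ s, X_s ι_s` of degree `-1`, where `ι_s` is the contraction with the vector field
dual to `dx_s`. -/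
def koszulHomotopy (X : ι → Module.End R N) : (Finset ι → N) →ₗ[R] (Finset ι → N) :=
  ∑ s, contract R s ∘ₗ (X s).compLeft (Finset ι)

theorem koszulDiff_eq_sum (D : ι → Module.End R N) (g : Finset ι → N) :
    koszulDiff D g = ∑ s, wedge R s ((D s).compLeft _ g) := by
  simp only [koszulDiff, LinearMap.sum_apply, LinearMap.comp_apply]

theorem koszulHomotopy_eq_sum (X : ι → Module.End R N) (g : Finset ι → N) :
    koszulHomotopy X g = ∑ s, contract R s ((X s).compLeft _ g) := by
  simp only [koszulHomotopy, LinearMap.sum_apply, LinearMap.comp_apply]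

theorem koszulDiff_apply (D : ι → Module.End R N) (g : Finset ι → N) (t : Finset ι) :
    koszulDiff D g t = ∑ s ∈ t, wedgeSign s t • D s (g (t.erase s)) := by
  rw [koszulDiff_eq_sum, Finset.sum_apply]
  exact Finset.sum_ite_mem_eq t fun s => wedgeSign s t • D s (g (t.erase s))

theorem koszulHomotopy_univ (X : ι → Module.End R N) (g : Finset ι → N) :
    koszulHomotopy X g Finset.univ = 0 := by
  simp [koszulHomotopy_eq_sum, contract_apply]

theorem koszulDiff_koszulDiff {D : ι → Module.End R N} (hD : ∀ r s, Commute (D r) (D s))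
    (g : Finset ι → N) : koszulDiff D (koszulDiff D g) = 0 := by
  have hsum : koszulDiff D (koszulDiff D g)
      = ∑ p : ι × ι, wedge R p.1 (wedge R p.2 ((D p.1 * D p.2).compLeft _ g)) := by
    simp only [koszulDiff_eq_sum, map_sum, Fintype.sum_prod_type, wedge_compLeft]
    exact Finset.sum_comm
  have hanti (r s : ι) : wedge R r (wedge R s ((D r * D s).compLeft _ g))
      + wedge R s (wedge R r ((D s * D r).compLeft _ g)) = 0 := by
    rw [wedge_wedge, (hD r s).eq, neg_add_cancel]
  have hdiag (s : ι) (g : Finset ι → N) : wedge R s (wedge R s g) = 0 := by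
    ext t
    simp [wedge_apply]
  rw [hsum]
  refine Finset.sum_involution (fun p _ => p.swap) (fun p _ => hanti p.1 p.2) ?_
    (fun p _ => Finset.mem_univ _) fun p _ => p.swap_swap
  rintro ⟨r, s⟩ _ hne hswap
  obtain rfl : s = r := congrArg Prod.fst hswap
  exact hne (hdiag s _)

theorem koszulDiff_koszulHomotopy_add {D X : ι → Module.End R N}
    (hX : ∀ r s, X r * D s = D s * X r + if r = s then 1 else 0) (g : Finset ι → N)
    (t : Finset ι) :
    koszulDiff D (koszulHomotopy X g) t + koszulHomotopy X (koszulDiff D g) t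
      = eulerOp D X (g t) + (tᶜ.card : R) • g t := by
  have hsum : koszulDiff D (koszulHomotopy X g) + koszulHomotopy X (koszulDiff D g)
      = ∑ s, ∑ r, (wedge R s (contract R r ((D s * X r).compLeft _ g))
        + contract R r (wedge R s ((X r * D s).compLeft _ g))) := by
    simp only [koszulDiff_eq_sum, koszulHomotopy_eq_sum, map_sum, Finset.sum_add_distrib,
      wedge_compLeft, contract_compLeft]
    congr 1
    exact Finset.sum_comm
  have hoff (s r : ι) (hrs : r ≠ s) : wedge R s (contract R r ((D s * X r).compLeft _ g))
      + contract R r (wedge R s ((X r * D s).compLeft _ g)) = 0 := by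
    rw [contract_wedge hrs, hX, if_neg hrs, add_zero, add_neg_cancel]
  have hdiag (s : ι) : wedge R s (contract R s ((D s * X s).compLeft _ g)) t
      + contract R s (wedge R s ((X s * D s).compLeft _ g)) t
      = D s (X s (g t)) + if s ∈ tᶜ then g t else 0 := by
    rw [wedge_contract_self, contract_wedge_self, hX, if_pos rfl]
    by_cases hs : s ∈ t <;> simp [hs]
  calc koszulDiff D (koszulHomotopy X g) t + koszulHomotopy X (koszulDiff D g) t
      = ∑ s, (D s (X s (g t)) + if s ∈ tᶜ then g t else 0) := by
        rw [← Pi.add_apply, hsum, Finset.sum_apply]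
        refine Finset.sum_congr rfl fun s _ => ?_
        rw [Finset.sum_eq_single s (fun r _ hrs => hoff s r hrs) (by simp), Pi.add_apply, hdiag]
    _ = eulerOp D X (g t) + (tᶜ.card : R) • g t := by
        rw [Finset.sum_add_distrib, Finset.sum_ite_mem_eq, Finset.sum_const,
          Nat.cast_smul_eq_nsmul, eulerOp, LinearMap.sum_apply]
        rfl

end Koszul

section EulerHomotopy

variable {ι : Type*} [LinearOrder ι] [Fintype ι] {K : Type*} [Field K] [CharZero K] {V : Type*}
  [AddCommGroup V] [Module K V] {D X : ι → Module.End K V}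

theorem exists_koszulDiff_eq_of_iSup_eigenspace_eq_top (hD : ∀ r s, Commute (D r) (D s))
    (hX : ∀ r s, X r * D s = D s * X r + if r = s then 1 else 0)
    (hE : ⨆ m : ℕ, (eulerOp D X).eigenspace (m : K) = ⊤) {g : Finset ι → V}
    (hg : koszulDiff D g = 0) : ∃ h, ∀ t ≠ Finset.univ, koszulDiff D h t = g t := by
  set T : Finset ι → Module.End K V := fun t => eulerOp D X + algebraMap K _ (tᶜ.card : K)
  have hhom (f : Finset ι → V) (t : Finset ι) :
      koszulDiff D (koszulHomotopy X f) t + koszulHomotopy X (koszulDiff D f) t = T t (f t) :=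
    koszulDiff_koszulHomotopy_add hX f t
  have hbij (t : Finset ι) (ht : t ≠ Finset.univ) : Function.Bijective (T t) := by
    have hunit := isUnit_sub_algebraMap_of_iSup_eigenspace_eq_top hE (c := -(tᶜ.card : K))
      fun m hm => by
        rw [← add_eq_zero_iff_eq_neg, ← Nat.cast_add, Nat.cast_eq_zero, Nat.add_eq_zero_iff,
          Finset.card_eq_zero, Finset.compl_eq_empty_iff] at hm
        exact ht hm.2
    rwa [map_neg, sub_neg_eq_add, Module.End.isUnit_iff] at hunit
  have hex (t : Finset ι) : ∃ v, T t v = koszulHomotopy X g t := by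
    by_cases ht : t = Finset.univ
    · exact ⟨0, by rw [map_zero, ht, koszulHomotopy_univ]⟩
    · exact (hbij t ht).2 _
  choose h hh using hex
  refine ⟨h, fun t ht => (hbij t ht).1 ?_⟩
  have hTh : koszulDiff D (koszulHomotopy X h) + koszulHomotopy X (koszulDiff D h)
      = koszulHomotopy X g := funext fun t => (hhom h t).trans (hh t)
  have hdTh := congrArg (koszulDiff D) hTh
  rw [map_add, koszulDiff_koszulDiff hD, zero_add] at hdTh
  rw [← hhom, ← hhom, koszulDiff_koszulDiff hD, hg, map_zero, hdTh]

end EulerHomotopy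

section KoszulDeRham

theorem subsingleton_DRForm {n i : ℕ} {N : Type*} (hi : n < i) : Subsingleton (DRForm n i N) := by
  have : IsEmpty {s : Finset (Fin n) // s.card = i} :=
    ⟨fun s => hi.not_ge <|
      s.2.symm.trans_le ((Finset.card_le_univ s.1).trans_eq (Fintype.card_fin n))⟩
  infer_instance

variable (k : Type u) [Field k] (A : Type v) [CommRing A] [Algebra k A] {n : ℕ}
  [Coordinates k A n] (N : Type w) [AddCommGroup N] [Module k N] [Module (DiffOp k A) N]
  [IsScalarTower k (DiffOp k A) N]

/-- The action of `∂_s` on the `𝒟`-module `N`, as a `k`-linear map. -/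
def partialEnd (s : Fin n) : Module.End k N := Algebra.lsmul k k N (dd k A s)

variable {k A N}

theorem partialEnd_apply (s : Fin n) (y : N) : partialEnd k A N s y = dd k A s • y := rfl

theorem commute_partialEnd (r s : Fin n) : Commute (partialEnd k A N r) (partialEnd k A N s) :=
  (dd_comm r s).map (Algebra.lsmul k k N)

theorem dRham_restrict (i : ℕ) (g : Finset (Fin n) → N) :
    dRham k A N i (fun s => g s.1) = fun t => koszulDiff (partialEnd k A N) g t.1 := by
  funext t
  rw [koszulDiff_apply]
  exact Finset.sum_coe_sort t.1 fun s => wedgeSign s t.1 • dd k A s • g (t.1.erase s)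

theorem extend_val_apply {i : ℕ} (ω : DRForm n i N) (s : {s : Finset (Fin n) // s.card = i}) :
    Function.extend Subtype.val ω 0 s.1 = ω s :=
  Subtype.val_injective.extend_apply ω 0 s

theorem dRham_eq_koszulDiff_extend {i : ℕ} (ω : DRForm n i N) :
    dRham k A N i ω
      = fun t => koszulDiff (partialEnd k A N) (Function.extend Subtype.val ω 0) t.1 := by
  rw [← dRham_restrict]
  simp only [extend_val_apply]

theorem dRham_dRham (i : ℕ) (ω : DRForm n i N) : dRham k A N (i + 1) (dRham k A N i ω) = 0 := by
  rw [dRham_eq_koszulDiff_extend ω, dRham_restrict, koszulDiff_koszulDiff commute_partialEnd]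
  rfl

theorem dRhamBoundaries_le_ker (i : ℕ) :
    dRhamBoundaries k A N i ≤ LinearMap.ker (dRham k A N i) := by
  cases i with
  | zero => exact bot_le
  | succ i =>
    rintro _ ⟨η, rfl⟩
    exact dRham_dRham i η

theorem mem_dRhamBoundaries_iff {i : ℕ} {ω : DRForm n i N} :
    ω ∈ dRhamBoundaries k A N i ↔ ∃ g, ∀ s, koszulDiff (partialEnd k A N) g s.1 = ω s := by
  cases i with
  | zero =>
    have hzero (g : Finset (Fin n) → N) (s : {s : Finset (Fin n) // s.card = 0}) :
        koszulDiff (partialEnd k A N) g s.1 = 0 := by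
      rw [koszulDiff_apply, Finset.card_eq_zero.mp s.2, Finset.sum_empty]
    simp only [hzero, exists_const]
    exact ⟨fun h s => (congrFun ((Submodule.mem_bot k).mp h) s).symm,
      fun h => (Submodule.mem_bot k).mpr (funext fun s => (h s).symm)⟩
  | succ i =>
    constructor
    · rintro ⟨η, rfl⟩
      exact ⟨Function.extend Subtype.val η 0,
        fun t => (congrFun (dRham_eq_koszulDiff_extend η) t).symm⟩
    · rintro ⟨g, hg⟩
      exact ⟨fun s => g s.1, (dRham_restrict i g).trans (funext hg)⟩

theorem koszulDiff_extend_eq_zero {i : ℕ} {ω : DRForm n i N} (hω : dRham k A N i ω = 0) :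
    koszulDiff (partialEnd k A N) (Function.extend Subtype.val ω 0) = 0 := by
  funext t
  by_cases ht : t.card = i + 1
  · exact congrFun ((dRham_eq_koszulDiff_extend ω).symm.trans hω) ⟨t, ht⟩
  · rw [koszulDiff_apply]
    refine Finset.sum_eq_zero fun s hs => ?_
    have hcard := Finset.card_erase_add_one hs
    have hnot : ¬ ∃ u : {u : Finset (Fin n) // u.card = i}, u.1 = t.erase s := by
      rintro ⟨u, hu⟩
      exact ht (by rw [← hcard, ← hu, u.2])
    rw [Function.extend_apply' _ _ _ hnot, Pi.zero_apply, map_zero, smul_zero]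

theorem mem_dRhamBoundaries_of_iSup_eigenspace_eq_top [CharZero k] {X : Fin n → Module.End k N}
    (hX : ∀ r s, X r * partialEnd k A N s = partialEnd k A N s * X r + if r = s then 1 else 0)
    (hE : ⨆ m : ℕ, (eulerOp (partialEnd k A N) X).eigenspace (m : k) = ⊤) {i : ℕ} (hi : i < n)
    {ω : DRForm n i N} (hω : dRham k A N i ω = 0) : ω ∈ dRhamBoundaries k A N i := by
  obtain ⟨g, hg⟩ := exists_koszulDiff_eq_of_iSup_eigenspace_eq_top commute_partialEnd hX hE
    (koszulDiff_extend_eq_zero hω)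
  refine mem_dRhamBoundaries_iff.mpr ⟨g, fun s => ?_⟩
  have hs : s.1 ≠ Finset.univ := fun h => by
    have hcard := s.2
    rw [h, Finset.card_univ, Fintype.card_fin] at hcard
    exact hi.ne' hcard
  rw [hg s.1 hs, extend_val_apply]

theorem subsingleton_HdR {i : ℕ} (hi : n < i) : Subsingleton (HdR k A N i) := by
  have : Subsingleton (DRForm n i N) := subsingleton_DRForm hi
  infer_instance

end KoszulDeRham

section FreeModules

variable {k : Type u} [Field k] {A : Type v} [CommRing A] [Algebra k A] {n : ℕ}
  [Coordinates k A n]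

open Coordinates

theorem DiffOp.induction_dd_mul [CharZero k] {p : DiffOp k A → Prop}
    (mulOp : ∀ a, p (DiffOp.mulOp a)) (add : ∀ P Q, p P → p Q → p (P + Q))
    (dd_mul : ∀ i P, p P → p (dd k A i * P)) (P : DiffOp k A) : p P := by
  have neg (a : A) (P : DiffOp k A) : DiffOp.mulOp (-a) * P = -(DiffOp.mulOp a * P) := by
    rw [map_neg, neg_mul]
  obtain ⟨c, rfl⟩ := opExpand_dd_surjective P
  induction c using Finsupp.induction_linear with
  | zero => rw [map_zero]; simpa using mulOp 0
  | add c c' h h' => rw [map_add]; exact add _ _ h h'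
  | single α a =>
    rw [opExpand_single]
    induction α using opMon_induction generalizing a with
    | h0 => rw [opMon_zero, mul_one]; exact mulOp a
    | h1 α i ih =>
      have hcomm : DiffOp.mulOp a * opMon (dd k A) (α + Finsupp.single i 1)
          = dd k A i * (DiffOp.mulOp a * opMon (dd k A) α)
            + DiffOp.mulOp (-pd (k := k) i a) * opMon (dd k A) α := by
        rw [opMon_add_single _ dd_comm, ← mul_assoc, ← mul_assoc, dd_mulOp, add_mul, neg,
          add_neg_cancel_right]
      rw [hcomm]
      exact add _ _ (dd_mul i _ (ih a)) (ih _)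

variable (k A) in
/-- The operator `P ↦ [P, x_s]` on `𝒟`. It lowers the order by one, and is the formal derivative
with respect to the symbol of `∂_s`. -/
def commCoord (s : Fin n) : Module.End k (DiffOp k A) :=
  LinearMap.mulRight k (DiffOp.mulOp (x k s)) - LinearMap.mulLeft k (DiffOp.mulOp (x k s))

theorem commCoord_apply (s : Fin n) (P : DiffOp k A) :
    commCoord k A s P = P * DiffOp.mulOp (x k s) - DiffOp.mulOp (x k s) * P := rfl

theorem commCoord_mulOp (s : Fin n) (a : A) : commCoord k A s (DiffOp.mulOp a) = 0 := by
  rw [commCoord_apply, ← map_mul, ← map_mul, mul_comm, sub_self]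

theorem commCoord_dd_mul (r s : Fin n) (P : DiffOp k A) :
    commCoord k A r (dd k A s * P)
      = dd k A s * commCoord k A r P + if r = s then P else 0 := by
  have hpd : DiffOp.mulOp (pd (k := k) s (x k r)) * P = if r = s then P else 0 := by
    rw [pd_x]
    by_cases h : s = r <;> simp [h, Ne.symm]
  rw [← hpd, commCoord_apply, commCoord_apply, mul_sub, ← mul_assoc (dd k A s) (DiffOp.mulOp _),
    dd_mulOp, add_mul]
  noncomm_ring

variable (S : Type*)

theorem mapRange_commCoord_mul_partialEnd (r s : Fin n) :
    (Finsupp.mapRange.linearMap (commCoord k A r) : Module.End k (S →₀ DiffOp k A))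
        * partialEnd k A (S →₀ DiffOp k A) s
      = partialEnd k A (S →₀ DiffOp k A) s * Finsupp.mapRange.linearMap (commCoord k A r)
        + if r = s then 1 else 0 := by
  refine LinearMap.ext fun v => Finsupp.ext fun b => (commCoord_dd_mul r s (v b)).trans ?_
  by_cases h : r = s <;> simp only [if_pos, if_neg, h, not_false_eq_true] <;> rfl

theorem mem_dRhamBoundaries_finsupp [CharZero k] {S : Type*} {i : ℕ} (hi : i < n)
    {ω : DRForm n i (S →₀ DiffOp k A)} (hω : dRham k A (S →₀ DiffOp k A) i ω = 0) :
    ω ∈ dRhamBoundaries k A (S →₀ DiffOp k A) i := by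
  refine mem_dRhamBoundaries_of_iSup_eigenspace_eq_top (mapRange_commCoord_mul_partialEnd S)
    (Submodule.eq_top_iff'.mpr fun v => ?_) hi hω
  induction v using Finsupp.induction_linear with
  | zero => exact zero_mem _
  | add v v' hv hv' => exact add_mem hv hv'
  | single a P =>
    induction P using DiffOp.induction_dd_mul with
    | mulOp b =>
      refine mem_iSup_eigenspace_eulerOp_of_forall_apply_eq_zero fun s => ?_
      rw [Finsupp.mapRange.linearMap_apply, Finsupp.mapRange_single, commCoord_mulOp,
        Finsupp.single_zero]
    | add P Q hP hQ => rw [Finsupp.single_add]; exact add_mem hP hQ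
    | dd_mul s P hP =>
      have h := apply_mem_iSup_eigenspace_eulerOp commute_partialEnd
        (mapRange_commCoord_mul_partialEnd S) s hP
      rwa [partialEnd_apply, Finsupp.smul_single] at h

end FreeModules

theorem BalTensor.op_smul_tmul {k : Type*} [Field k] {D : Type*} [Ring D] [Algebra k D]
    {X : Type*} [AddCommGroup X] [Module k X] [Module Dᵐᵒᵖ X] {N : Type*} [AddCommGroup N]
    [Module k N] [Module D N] (δ : D) (x : X) (y : N) :
    (BalTensor.tmul (op δ • x) y : BalTensor k D X N) = BalTensor.tmul x (δ • y) :=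
  (Submodule.Quotient.eq _).mpr (Submodule.subset_span ⟨x, δ, y, rfl⟩)

section Coinvariants

variable (k : Type u) [Field k] (A : Type v) [CommRing A] [Algebra k A] {n : ℕ}
  [Coordinates k A n] (N : Type w) [AddCommGroup N] [Module k N] [Module (DiffOp k A) N]
  [IsScalarTower k (DiffOp k A) N]

/-- The subspace `∑_s ∂_s N` of `N`. -/
def partialRange : Submodule k N :=
  LinearMap.range (LinearMap.lsum k (fun _ => N) k (partialEnd k A N))

variable {N}

theorem mem_partialRange {v : N} : v ∈ partialRange k A N ↔
    ∃ u : Fin n → N, ∑ s, dd k A s • u s = v := by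
  simp only [partialRange, LinearMap.mem_range, LinearMap.lsum_apply, LinearMap.sum_apply,
    LinearMap.comp_apply, LinearMap.proj_apply, partialEnd_apply]

theorem dd_smul_mem_partialRange (s : Fin n) (v : N) : dd k A s • v ∈ partialRange k A N :=
  (mem_partialRange k A).mpr ⟨Pi.single s v, by simp [Pi.single_apply]⟩

theorem mem_dRhamBoundaries_iff_apply_mem_partialRange {m : ℕ} (hm : m = n) {ω : DRForm n m N}
    (t : {s : Finset (Fin n) // s.card = m}) :
    ω ∈ dRhamBoundaries k A N m ↔ ω t ∈ partialRange k A N := by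
  have huniv (t : {s : Finset (Fin n) // s.card = m}) : t.1 = Finset.univ := by
    rw [← Finset.card_eq_iff_eq_univ, t.2, hm, Fintype.card_fin]
  have herase : Function.Injective fun s : Fin n => Finset.univ.erase s := fun r s =>
    Finset.erase_injOn Finset.univ (Finset.mem_univ r) (Finset.mem_univ s)
  rw [mem_dRhamBoundaries_iff, mem_partialRange]
  constructor
  · rintro ⟨g, hg⟩
    refine ⟨fun s => wedgeSign s Finset.univ • g (Finset.univ.erase s), ?_⟩
    rw [← hg, koszulDiff_apply, huniv]
    exact Finset.sum_congr rfl fun s _ => smul_comm _ _ _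
  · rintro ⟨u, hu⟩
    refine ⟨Function.extend (fun s => Finset.univ.erase s)
      (fun s => wedgeSign s Finset.univ • u s) 0, fun t' => ?_⟩
    rw [Subtype.ext ((huniv t').trans (huniv t).symm), ← hu, koszulDiff_apply, huniv]
    refine Finset.sum_congr rfl fun s _ => ?_
    rw [herase.extend_apply, map_zsmul, smul_smul, wedgeSign_mul_self, one_smul, partialEnd_apply]

variable (N) in
/-- The pairing `A^τ × N → N / ∑_s ∂_s N`, `(a, v) ↦ [a v]`. -/
def coinvariantPairing : Transpose k A A →ₗ[k] N →ₗ[k] N ⧸ partialRange k A N :=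
  ((Algebra.lsmul k k N).toLinearMap ∘ₗ DiffOp.mulOp.toLinearMap ∘ₗ
    (Transpose.of k A).symm.toLinearMap).compr₂ (partialRange k A N).mkQ

theorem coinvariantPairing_apply (a : A) (v : N) :
    coinvariantPairing k A N (Transpose.of k A a) v
      = Submodule.Quotient.mk ((DiffOp.mulOp a : DiffOp k A) • v) := rfl

end Coinvariants

section TopDegree

variable {k : Type u} [Field k] [CharZero k] {A : Type v} [CommRing A] [Algebra k A] {n : ℕ}
  [Coordinates k A n]

open Coordinates

theorem op_mulOp_smul_of (a b : A) :
    op (DiffOp.mulOp a : DiffOp k A) • Transpose.of k A b = Transpose.of k A (a * b) := by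
  rw [Transpose.op_smul_of, tau, transposition, DiffOp.lift_mulOp]
  rfl

theorem op_dd_smul_of (s : Fin n) (a : A) :
    op (dd k A s) • Transpose.of k A a = Transpose.of k A (-pd (k := k) s a) := by
  rw [Transpose.op_smul_of, tau, transposition, DiffOp.lift_dd, unop_op, neg_smul, dd,
    DiffOp.ofDerivation_smul]

variable (k A) (N : Type w) [AddCommGroup N] [Module k N] [Module (DiffOp k A) N]

/-- The augmentation `Ω^n(N) = N → A^τ ⊗_𝒟 N`, `v ↦ 1 ⊗ v`. -/
def oneTmul : N →ₗ[k] BalTensor k (DiffOp k A) (Transpose k A A) N :=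
  (balancedRel k (DiffOp k A) (Transpose k A A) N).mkQ ∘ₗ
    TensorProduct.mk k (Transpose k A A) N (Transpose.of k A (1 : A))

variable {N}

theorem oneTmul_apply (v : N) : oneTmul k A N v = BalTensor.tmul (Transpose.of k A 1) v := rfl

theorem oneTmul_mulOp_smul (a : A) (v : N) :
    oneTmul k A N ((DiffOp.mulOp a : DiffOp k A) • v) = BalTensor.tmul (Transpose.of k A a) v := by
  rw [oneTmul_apply, ← BalTensor.op_smul_tmul, op_mulOp_smul_of, mul_one]

theorem oneTmul_dd_smul (s : Fin n) (v : N) : oneTmul k A N (dd k A s • v) = 0 := by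
  rw [oneTmul_apply, ← BalTensor.op_smul_tmul, op_dd_smul_of, Derivation.map_one_eq_zero, neg_zero,
    map_zero]
  exact congrArg Submodule.Quotient.mk (TensorProduct.zero_tmul _ v)

theorem oneTmul_surjective : Function.Surjective (oneTmul k A N) := by
  rw [← LinearMap.range_eq_top, Submodule.eq_top_iff']
  intro z
  obtain ⟨z, rfl⟩ := Submodule.Quotient.mk_surjective _ z
  induction z using TensorProduct.induction_on with
  | zero => exact zero_mem _
  | add y z hy hz => exact add_mem hy hz
  | tmul r v => exact ⟨_, oneTmul_mulOp_smul k A ((Transpose.of k A).symm r) v⟩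

variable (N) in
/-- The augmentation `Ω^n(N) → A^τ ⊗_𝒟 N`, `v dx_1 ∧ ⋯ ∧ dx_n ↦ 1 ⊗ v`. -/
def topTmul {m : ℕ} (hm : m = n) :
    DRForm n m N →ₗ[k] BalTensor k (DiffOp k A) (Transpose k A A) N :=
  oneTmul k A N ∘ₗ
    LinearMap.proj ⟨Finset.univ, by rw [Finset.card_univ, Fintype.card_fin, hm]⟩

theorem topTmul_surjective {m : ℕ} (hm : m = n) : Function.Surjective (topTmul k A N hm) :=
  (oneTmul_surjective k A).comp (Function.surjective_eval _)

variable [IsScalarTower k (DiffOp k A) N]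

theorem coinvariantPairing_op_smul (P : DiffOp k A) (r : Transpose k A A) (v : N) :
    coinvariantPairing k A N (op P • r) v = coinvariantPairing k A N r (P • v) := by
  induction P using DiffOp.gen_induction generalizing r v with
  | hA a =>
    obtain ⟨b, rfl⟩ := (Transpose.of k A).surjective r
    rw [op_mulOp_smul_of, coinvariantPairing_apply, coinvariantPairing_apply, ← mul_smul,
      ← map_mul, mul_comm]
  | hdd s =>
    obtain ⟨b, rfl⟩ := (Transpose.of k A).surjective r
    rw [op_dd_smul_of, coinvariantPairing_apply, coinvariantPairing_apply, eq_comm,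
      Submodule.Quotient.eq, ← mul_smul, ← sub_smul, map_neg, sub_neg_eq_add, ← dd_mulOp, mul_smul]
    exact dd_smul_mem_partialRange k A s _
  | hadd P Q hP hQ =>
    rw [op_add, add_smul, map_add, LinearMap.add_apply, hP, hQ, add_smul, map_add]
  | hmul P Q hP hQ => rw [op_mul, mul_smul, hQ, hP, mul_smul]

theorem ker_oneTmul : LinearMap.ker (oneTmul k A N) = partialRange k A N := by
  refine le_antisymm (fun v hv => ?_) fun v hv => ?_
  · have hle : balancedRel k (DiffOp k A) (Transpose k A A) N
        ≤ LinearMap.ker (TensorProduct.lift (coinvariantPairing k A N)) := by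
      refine Submodule.span_le.mpr ?_
      rintro _ ⟨r, P, v, rfl⟩
      exact LinearMap.sub_mem_ker_iff.mpr (coinvariantPairing_op_smul k A P r v)
    have hzero : coinvariantPairing k A N (Transpose.of k A 1) v = 0 :=
      hle ((Submodule.Quotient.mk_eq_zero _).mp hv)
    rwa [coinvariantPairing_apply, map_one, one_smul, Submodule.Quotient.mk_eq_zero] at hzero
  · obtain ⟨u, rfl⟩ := (mem_partialRange k A).mp hv
    simp only [LinearMap.mem_ker, map_sum, oneTmul_dd_smul, Finset.sum_const_zero]

theorem ker_topTmul {m : ℕ} (hm : m = n) :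
    LinearMap.ker (topTmul k A N hm) = dRhamBoundaries k A N m := by
  ext ω
  rw [topTmul, LinearMap.ker_comp, ker_oneTmul,
    mem_dRhamBoundaries_iff_apply_mem_partialRange k A hm]
  rfl

end TopDegree

section CoefficientMaps

variable {k : Type u} [Field k] {A A' : Type*} [CommRing A] [Algebra k A] [CommRing A']
  [Algebra k A'] {n : ℕ} [Coordinates k A n] [Coordinates k A' n]
  {N N' : Type*} [AddCommGroup N] [Module k N] [Module (DiffOp k A) N]
  [IsScalarTower k (DiffOp k A) N] [AddCommGroup N'] [Module k N'] [Module (DiffOp k A') N']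
  [IsScalarTower k (DiffOp k A') N']

theorem dRham_map_coeff {F : Type*} [FunLike F N N'] [AddMonoidHomClass F N N'] (φ : F)
    (hφ : ∀ s v, φ (dd k A s • v) = dd k A' s • φ v) {i : ℕ} (ω : DRForm n i N) :
    dRham k A' N' i (fun t => φ (ω t)) = fun t => φ (dRham k A N i ω t) := by
  funext t
  refine Eq.trans (Finset.sum_congr rfl fun s _ => ?_) (map_sum φ _ _).symm
  rw [map_zsmul, hφ]

theorem map_compLeft_dRhamBoundaries {N' : Type*} [AddCommGroup N'] [Module k N']
    [Module (DiffOp k A) N'] [IsScalarTower k (DiffOp k A) N'] (φ : N →ₗ[k] N')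
    (hφ : ∀ s v, φ (dd k A s • v) = dd k A s • φ v) (hsurj : Function.Surjective φ) (i : ℕ) :
    (dRhamBoundaries k A N i).map (φ.compLeft _) = dRhamBoundaries k A N' i := by
  cases i with
  | zero => exact Submodule.map_bot _
  | succ i =>
    have hcomm : φ.compLeft _ ∘ₗ dRham k A N i = dRham k A N' i ∘ₗ φ.compLeft _ :=
      LinearMap.ext fun ω => (dRham_map_coeff φ hφ ω).symm
    have htop : LinearMap.range (φ.compLeft {s : Finset (Fin n) // s.card = i}) = ⊤ :=
      LinearMap.range_eq_top.mpr hsurj.comp_left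
    rw [dRhamBoundaries, dRhamBoundaries, ← LinearMap.range_comp, hcomm,
      LinearMap.range_comp_of_range_eq_top _ htop]

end CoefficientMaps

section SignedResolution

theorem range_neg_one_pow_zsmul {R X Y : Type*} [Ring R] [AddCommGroup X] [AddCommGroup Y]
    [Module R X] [Module R Y] (f : X →ₗ[R] Y) (m : ℕ) :
    LinearMap.range ((-1 : ℤ) ^ m • f) = LinearMap.range f := by
  rcases neg_one_pow_eq_or ℤ m with h | h
  · rw [h, one_smul]
  · rw [h, neg_smul, one_smul, LinearMap.range_neg]

theorem ker_neg_one_pow_zsmul {R X Y : Type*} [Ring R] [AddCommGroup X] [AddCommGroup Y]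
    [Module R X] [Module R Y] (f : X →ₗ[R] Y) (m : ℕ) :
    LinearMap.ker ((-1 : ℤ) ^ m • f) = LinearMap.ker f := by
  rcases neg_one_pow_eq_or ℤ m with h | h
  · rw [h, one_smul]
  · rw [h, neg_smul, one_smul, LinearMap.ker_neg]

variable (k : Type*) [Field k] (D : Type*) [Ring D] [Algebra k D] (N : Type*) [AddCommGroup N]
  [Module D N]

/-- The differential `F_{p+1} → F_p` of the canonical free resolution, with the sign `(-1)^{j+p}`
that it carries in the total complex of a double complex, in total degree `j`. -/
def signedD (j p : ℕ) : freeRes D N (p + 1) →ₗ[k] freeRes D N p :=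
  (-1 : ℤ) ^ (j + p) • (freeRes.d D N p).restrictScalars k

variable {k D N}

theorem signedD_apply (j p : ℕ) (v : freeRes D N (p + 1)) :
    signedD k D N j p v = (-1 : ℤ) ^ (j + p) • freeRes.d D N p v := rfl

theorem signedD_smul (j p : ℕ) (P : D) (v : freeRes D N (p + 1)) :
    signedD k D N j p (P • v) = P • signedD k D N j p v := by
  rw [signedD_apply, map_smul, smul_comm, signedD_apply]

theorem range_signedD (j p : ℕ) :
    LinearMap.range (signedD k D N j p)
      = (LinearMap.range (freeRes.d D N p)).restrictScalars k := by
  rw [signedD, range_neg_one_pow_zsmul, LinearMap.range_restrictScalars]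

theorem ker_signedD (j p : ℕ) :
    LinearMap.ker (signedD k D N j p) = (LinearMap.ker (freeRes.d D N p)).restrictScalars k := by
  rw [signedD, ker_neg_one_pow_zsmul, LinearMap.ker_restrictScalars]

theorem range_compLeft_signedD_zero [Module k N] [IsScalarTower k D N] (j : ℕ)
    (I : Type*) :
    LinearMap.range ((signedD k D N j 0).compLeft I)
      = LinearMap.ker (((freeRes.aug D N).restrictScalars k).compLeft I) := by
  rw [LinearMap.range_compLeft, LinearMap.ker_compLeft, range_signedD, freeRes.exact_zero,
    LinearMap.ker_restrictScalars]

theorem range_compLeft_signedD_succ (j p : ℕ) (I : Type*) :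
    LinearMap.range ((signedD k D N j (p + 1)).compLeft I)
      = LinearMap.ker ((signedD k D N j p).compLeft I) := by
  rw [LinearMap.range_compLeft, LinearMap.ker_compLeft, range_signedD, freeRes.exact_succ,
    ker_signedD]

end SignedResolution

section DoubleComplex

theorem mem_range_sup_ker_iff {R : Type*} [Ring R] {X X' Y Y' : Type*} [AddCommGroup X]
    [AddCommGroup X'] [AddCommGroup Y] [AddCommGroup Y'] [Module R X] [Module R X'] [Module R Y]
    [Module R Y'] {d : X →ₗ[R] X'} {δ : Y →ₗ[R] X} {d' : Y →ₗ[R] Y'} {δ' : Y' →ₗ[R] X'}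
    (hcomm : d ∘ₗ δ = δ' ∘ₗ d') {x : X} {y : Y'} (hxy : d x = δ' y) :
    x ∈ LinearMap.range δ ⊔ LinearMap.ker d ↔ y ∈ LinearMap.range d' ⊔ LinearMap.ker δ' := by
  rw [← Submodule.comap_map_eq, ← Submodule.comap_map_eq, Submodule.mem_comap,
    Submodule.mem_comap, ← LinearMap.range_comp, ← LinearMap.range_comp, hcomm, hxy]

variable {R : Type*} [Ring R] {C : ℕ → ℕ → Type*} [∀ a p, AddCommGroup (C a p)]
  [∀ a p, Module R (C a p)] {d : ∀ a p, C a p →ₗ[R] C (a + 1) p}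
  {δ : ∀ a p, C a (p + 1) →ₗ[R] C a p} {i : ℕ}

theorem exists_totalCycle_zero_eq (hdd : ∀ a p x, d (a + 1) p (d a p x) = 0)
    (hdδ : ∀ a p x, d a p (δ a p x) = δ (a + 1) p (d a (p + 1) x))
    (hδ : ∀ a p, LinearMap.ker (δ a p) ≤ LinearMap.range (δ a (p + 1))) {x : C i 0}
    (hx : d i 0 x ∈ LinearMap.range (δ (i + 1) 0)) :
    ∃ w : ∀ p, C (i + p) p, w 0 = x ∧ ∀ p, d (i + p) p (w p) = δ (i + p + 1) p (w (p + 1)) := by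
  have step (p : ℕ) (x : {x // d (i + p) p x ∈ LinearMap.range (δ (i + p + 1) p)}) :
      ∃ y : {y // d (i + p + 1) (p + 1) y ∈ LinearMap.range (δ (i + p + 1 + 1) (p + 1))},
        d (i + p) p x.1 = δ (i + p + 1) p y.1 := by
    obtain ⟨x, y, hy⟩ := x
    exact ⟨⟨y, hδ _ _ (by rw [LinearMap.mem_ker, ← hdδ, hy, hdd])⟩, hy.symm⟩
  choose next hnext using step
  exact ⟨fun p => (Nat.rec ⟨x, hx⟩ next p :
    {x // d (i + p) p x ∈ LinearMap.range (δ (i + p + 1) p)}).1, rfl, fun p => hnext p _⟩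

theorem exists_totalCycle_apply_eq (hdδ : ∀ a p x, d a p (δ a p x) = δ (a + 1) p (d a (p + 1) x))
    (hδδ : ∀ a p x, δ a p (δ a (p + 1) x) = 0) (j : ℕ)
    (hd : ∀ a p, a + 1 < i + j → LinearMap.ker (d (a + 1) p) ≤ LinearMap.range (d a p))
    (y : ∀ p, C (i + p) p)
    (hy : ∀ p, p + 1 = j → δ (i + p + 1) p (y (p + 1)) ∈ LinearMap.range (d (i + p) p)) :
    ∃ w : ∀ p, C (i + p) p, w j = y j ∧
      ∀ p < j, d (i + p) p (w p) = δ (i + p + 1) p (w (p + 1)) := by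
  induction j generalizing y with
  | zero => exact ⟨y, rfl, fun p hp => absurd hp p.not_lt_zero⟩
  | succ j ih =>
    obtain ⟨x, hx⟩ := hy j rfl
    obtain ⟨w, hwj, hw⟩ := ih (fun a p ha => hd a p (by omega)) (Function.update y j x) (by
      rintro p rfl
      rw [Function.update_self]
      exact hd _ _ (by omega) (LinearMap.mem_ker.mpr
        ((hdδ _ _ _).trans ((congrArg _ hx).trans (hδδ _ _ _)))))
    rw [Function.update_self] at hwj
    refine ⟨Function.update w (j + 1) (y (j + 1)), Function.update_self _ _ _, fun p hp => ?_⟩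
    rw [Function.update_of_ne (by omega)]
    rcases (Nat.lt_succ_iff.mp hp).eq_or_lt with rfl | hp
    · rw [Function.update_self, hwj, hx]
    · rw [Function.update_of_ne (by omega), hw p hp]

end DoubleComplex

section Subquotients

variable {R : Type u} [Field R] {X : Type*} {Y : Type v} [AddCommMonoid X] [AddCommGroup Y]
  [Module R X] [Module R Y] {Z : Submodule R Y} {f : X →ₗ[R] Y} {hf : ∀ x, f x ∈ Z}

/-- The map into a subquotient `Z / B` that sends `x` to the class of `f x ∈ Z`. -/
def SubQuot.ofMemCycles (B : Submodule R Y) (f : X →ₗ[R] Y) (hf : ∀ x, f x ∈ Z) :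
    X →ₗ[R] SubQuot Z B :=
  (B.submoduleOf Z).mkQ ∘ₗ f.codRestrict Z hf

variable {B : Submodule R Y}

theorem SubQuot.ofMemCycles_eq_iff {x : X} {c : SubQuot Z B} :
    SubQuot.ofMemCycles B f hf x = c ↔ ∃ z : Z, z.1 = f x ∧ Submodule.Quotient.mk z = c := by
  refine ⟨fun h => ⟨⟨f x, hf x⟩, rfl, h⟩, ?_⟩
  rintro ⟨z, hz, rfl⟩
  exact congrArg Submodule.Quotient.mk (Subtype.ext hz.symm)

theorem SubQuot.mem_ker_ofMemCycles_iff {x : X} :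
    x ∈ LinearMap.ker (SubQuot.ofMemCycles B f hf) ↔ f x ∈ B :=
  Submodule.Quotient.mk_eq_zero _

theorem SubQuot.ofMemCycles_surjective (h : ∀ y ∈ Z, ∃ x, f x = y) :
    Function.Surjective (SubQuot.ofMemCycles B f hf) := by
  rintro ⟨y, hy⟩
  obtain ⟨x, rfl⟩ := h y hy
  exact ⟨x, rfl⟩

end Subquotients

section Comparison

variable (k : Type u) [Field k] (A : Type v) [CommRing A] [Algebra k A] (n : ℕ)
  (N : Type w) [AddCommGroup N] [Module (DiffOp k A) N]

/-- The differential `Ω^a(F_{p+1}) → Ω^a(F_p)` of the double complex `Ω^•(F_•)`, in total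
degree `j`. -/
abbrev resolutionD (j a p : ℕ) :
    DRForm n a (freeRes (DiffOp k A) N (p + 1)) →ₗ[k] DRForm n a (freeRes (DiffOp k A) N p) :=
  (signedD k (DiffOp k A) N j p).compLeft _

/-- The map `Ω^a(F_0) → Ω^a(N)` given by the augmentation `F_0 → N`. -/
abbrev augForm [Module k N] [IsScalarTower k (DiffOp k A) N] (a : ℕ) :
    DRForm n a (freeRes (DiffOp k A) N 0) →ₗ[k] DRForm n a N :=
  ((freeRes.aug (DiffOp k A) N).restrictScalars k).compLeft _

variable {k A n N}

theorem ker_augForm [Module k N] [IsScalarTower k (DiffOp k A) N] (j a : ℕ) :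
    LinearMap.ker (augForm k A n N a) = LinearMap.range (resolutionD k A n N j a 0) :=
  (range_compLeft_signedD_zero j _).symm

variable [Coordinates k A n] {i j : ℕ}

theorem isTotalCycle_iff {w : ∀ p, DRForm n (i + p) (freeRes (DiffOp k A) N p)} :
    IsTotalCycle k A N i j w ↔ ∀ p, dRham k A (freeRes (DiffOp k A) N p) (i + p) (w p)
      = resolutionD k A n N j (i + p + 1) p (w (p + 1)) :=
  Iff.rfl

theorem dRham_resolutionD (a p : ℕ) (ω : DRForm n a (freeRes (DiffOp k A) N (p + 1))) :
    dRham k A _ a (resolutionD k A n N j a p ω)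
      = resolutionD k A n N j (a + 1) p (dRham k A _ a ω) :=
  dRham_map_coeff (signedD k (DiffOp k A) N j p) (fun s => signedD_smul j p (dd k A s)) ω

variable (k A N i j) in
/-- The cycles of degree `j` of the total complex of the double complex `Ω^•(F_•)`. -/
def totalCycles : Submodule k (∀ p, DRForm n (i + p) (freeRes (DiffOp k A) N p)) where
  carrier := {w | IsTotalCycle k A N i j w}
  add_mem' hw hw' := isTotalCycle_iff.mpr fun p => by
    rw [Pi.add_apply, Pi.add_apply, map_add, map_add, isTotalCycle_iff.mp hw,
      isTotalCycle_iff.mp hw']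
  zero_mem' := isTotalCycle_iff.mpr fun p => by
    rw [Pi.zero_apply, Pi.zero_apply, map_zero, map_zero]
  smul_mem' c w hw := isTotalCycle_iff.mpr fun p => by
    rw [Pi.smul_apply, Pi.smul_apply, map_smul, map_smul, isTotalCycle_iff.mp hw]

variable (k A N i j) in
/-- The component `w_p ∈ Ω^{i+p}(F_p)` of a total cycle `w`. -/
def totalCycles.component (p : ℕ) :
    totalCycles k A N i j →ₗ[k] DRForm n (i + p) (freeRes (DiffOp k A) N p) :=
  LinearMap.proj p ∘ₗ (totalCycles k A N i j).subtype

theorem mem_totalCycles {w : ∀ p, DRForm n (i + p) (freeRes (DiffOp k A) N p)} :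
    w ∈ totalCycles k A N i j ↔ IsTotalCycle k A N i j w :=
  Iff.rfl

section Bottom

variable [Module k N] [IsScalarTower k (DiffOp k A) N]

theorem dRham_augForm (a : ℕ) (ω : DRForm n a (freeRes (DiffOp k A) N 0)) :
    dRham k A N a (augForm k A n N a ω) = augForm k A n N (a + 1) (dRham k A _ a ω) :=
  dRham_map_coeff ((freeRes.aug (DiffOp k A) N).restrictScalars k)
    (fun s => map_smul (freeRes.aug (DiffOp k A) N) (dd k A s)) ω

theorem dRham_augForm_eq_zero_iff (j a : ℕ) {ω : DRForm n a (freeRes (DiffOp k A) N 0)} :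
    dRham k A N a (augForm k A n N a ω) = 0
      ↔ dRham k A _ a ω ∈ LinearMap.range (resolutionD k A n N j (a + 1) 0) := by
  rw [dRham_augForm, ← ker_augForm, LinearMap.mem_ker]

theorem augForm_mem_dRhamBoundaries_iff (j a : ℕ) {ω : DRForm n a (freeRes (DiffOp k A) N 0)} :
    augForm k A n N a ω ∈ dRhamBoundaries k A N a
      ↔ ω ∈ LinearMap.range (resolutionD k A n N j a 0) ⊔ dRhamBoundaries k A _ a := by
  rw [← map_compLeft_dRhamBoundaries ((freeRes.aug (DiffOp k A) N).restrictScalars k)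
      (fun s => map_smul (freeRes.aug (DiffOp k A) N) (dd k A s)) (freeRes.aug_surjective _ _),
    ← Submodule.mem_comap, Submodule.comap_map_eq, ker_augForm j, sup_comm]

theorem IsTotalCycle.dRham_augForm_eq_zero
    {w : ∀ p, DRForm n (i + p) (freeRes (DiffOp k A) N p)} (hw : IsTotalCycle k A N i j w) :
    dRham k A N i (augForm k A n N i (w 0)) = 0 :=
  (dRham_augForm_eq_zero_iff j i).mpr ⟨w 1, (hw 0).symm⟩

theorem exists_isTotalCycle_augForm_eq {ω : DRForm n i N} (hω : dRham k A N i ω = 0) :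
    ∃ w, IsTotalCycle k A N i j w ∧ augForm k A n N i (w 0) = ω := by
  obtain ⟨η, rfl⟩ : ∃ η, augForm k A n N i η = ω :=
    (freeRes.aug_surjective (DiffOp k A) N).comp_left ω
  obtain ⟨w, hw₀, hw⟩ := exists_totalCycle_zero_eq (i := i)
    (C := fun a p => DRForm n a (freeRes (DiffOp k A) N p)) (d := fun a p => dRham k A _ a)
    (δ := resolutionD k A n N j) (fun a p => dRham_dRham a) dRham_resolutionD
    (fun a p => (range_compLeft_signedD_succ j p _).ge)
    ((dRham_augForm_eq_zero_iff j i).mp hω)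
  exact ⟨w, hw, congrArg (augForm k A n N i) hw₀⟩

variable (k A N i j) in
/-- The map from total cycles to de Rham cohomology given by the augmentation
`Ω^•(F_•) → Ω^•(N)`. -/
def totalCyclesToHdR : totalCycles k A N i j →ₗ[k] HdR k A N i :=
  SubQuot.ofMemCycles (dRhamBoundaries k A N i)
    (augForm k A n N i ∘ₗ totalCycles.component k A N i j 0)
    fun w => LinearMap.mem_ker.mpr (mem_totalCycles.mp w.2).dRham_augForm_eq_zero

theorem totalCyclesToHdR_surjective : Function.Surjective (totalCyclesToHdR k A N i j) :=
  SubQuot.ofMemCycles_surjective fun _ hω => by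
    obtain ⟨w, hw, h⟩ := exists_isTotalCycle_augForm_eq (LinearMap.mem_ker.mp hω)
    exact ⟨⟨w, hw⟩, h⟩

theorem mem_ker_totalCyclesToHdR_iff {w : totalCycles k A N i j} :
    w ∈ LinearMap.ker (totalCyclesToHdR k A N i j) ↔
      w.1 0 ∈ LinearMap.range (resolutionD k A n N j i 0) ⊔ dRhamBoundaries k A _ i :=
  SubQuot.mem_ker_ofMemCycles_iff.trans (augForm_mem_dRhamBoundaries_iff j i)

end Bottom

variable [CharZero k]

section Top

variable {m : ℕ} (hm : m = n)

theorem topTmul_resolutionD (p : ℕ) :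
    topTmul k A _ hm ∘ₗ resolutionD k A n N j m p = (-1 : ℤ) ^ (j + p) •
      torD k (DiffOp k A) (Transpose k A A) N p ∘ₗ topTmul k A _ hm := by
  have hsign : resolutionD k A n N j m p
      = (-1 : ℤ) ^ (j + p) • ((freeRes.d (DiffOp k A) N p).restrictScalars k).compLeft _ := rfl
  rw [hsign, LinearMap.comp_smul]
  rfl

theorem ker_torD_topTmul (j p : ℕ) :
    LinearMap.ker (torD k (DiffOp k A) (Transpose k A A) N p ∘ₗ topTmul k A _ hm)
      = (dRhamBoundaries k A (freeRes (DiffOp k A) N p) m).comap (resolutionD k A n N j m p) := by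
  rw [← ker_topTmul k A hm, ← LinearMap.ker_comp, topTmul_resolutionD, ker_neg_one_pow_zsmul]

theorem range_torD (j p : ℕ) :
    LinearMap.range (torD k (DiffOp k A) (Transpose k A A) N p)
      = (LinearMap.range (resolutionD k A n N j m p)).map (topTmul k A _ hm) := by
  rw [← LinearMap.range_comp, topTmul_resolutionD, range_neg_one_pow_zsmul,
    LinearMap.range_comp_of_range_eq_top _
      (LinearMap.range_eq_top.mpr (topTmul_surjective k A hm))]

theorem topTmul_mem_range_torD_iff (j p : ℕ)
    {ω : DRForm n m (freeRes (DiffOp k A) N p)} :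
    topTmul k A _ hm ω ∈ LinearMap.range (torD k (DiffOp k A) (Transpose k A A) N p)
      ↔ ω ∈ LinearMap.range (resolutionD k A n N j m p) ⊔ dRhamBoundaries k A _ m := by
  rw [range_torD hm j, ← Submodule.mem_comap, Submodule.comap_map_eq, ker_topTmul]

end Top

theorem dRhamBoundaries_finsupp {S : Type*} (hi : i < n) :
    dRhamBoundaries k A (S →₀ DiffOp k A) i = LinearMap.ker (dRham k A (S →₀ DiffOp k A) i) :=
  (dRhamBoundaries_le_ker i).antisymm fun _ => mem_dRhamBoundaries_finsupp hi

theorem IsTotalCycle.mem_iff_mem_succ {w : ∀ p, DRForm n (i + p) (freeRes (DiffOp k A) N p)}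
    (hw : IsTotalCycle k A N i j w) {p : ℕ} (hp : i + p < n) :
    w p ∈ LinearMap.range (resolutionD k A n N j (i + p) p) ⊔ dRhamBoundaries k A _ (i + p)
      ↔ w (p + 1) ∈ LinearMap.range (resolutionD k A n N j (i + (p + 1)) (p + 1)) ⊔
        dRhamBoundaries k A _ (i + (p + 1)) := by
  have hrange : LinearMap.range (resolutionD k A n N j (i + (p + 1)) (p + 1))
      = LinearMap.ker (resolutionD k A n N j (i + p + 1) p) :=
    range_compLeft_signedD_succ j p _
  rw [dRhamBoundaries_finsupp hp, hrange, sup_comm (LinearMap.ker _)]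
  exact mem_range_sup_ker_iff (LinearMap.ext (dRham_resolutionD (i + p) p)) (hw p)

theorem IsTotalCycle.mem_zero_iff_mem {w : ∀ p, DRForm n (i + p) (freeRes (DiffOp k A) N p)}
    (hw : IsTotalCycle k A N i j w) {p : ℕ} (hp : i + p ≤ n) :
    w 0 ∈ LinearMap.range (resolutionD k A n N j i 0) ⊔ dRhamBoundaries k A _ i
      ↔ w p ∈ LinearMap.range (resolutionD k A n N j (i + p) p) ⊔
        dRhamBoundaries k A _ (i + p) := by
  induction p with
  | zero => rfl
  | succ p ih => exact (ih (by omega)).trans (hw.mem_iff_mem_succ (by omega))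

theorem IsTotalCycle.topTmul_mem_torCycles (hij : i + j = n)
    {w : ∀ p, DRForm n (i + p) (freeRes (DiffOp k A) N p)} (hw : IsTotalCycle k A N i j w) :
    topTmul k A _ hij (w j) ∈ torCycles k (DiffOp k A) (Transpose k A A) N j := by
  cases j with
  | zero => exact Submodule.mem_top
  | succ j => exact (ker_torD_topTmul hij (j + 1) j).ge ⟨w j, hw j⟩

theorem exists_isTotalCycle_topTmul_eq (hij : i + j = n)
    {y : BalTensor k (DiffOp k A) (Transpose k A A) (freeRes (DiffOp k A) N j)}
    (hy : y ∈ torCycles k (DiffOp k A) (Transpose k A A) N j) :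
    ∃ w, IsTotalCycle k A N i j w ∧ topTmul k A _ hij (w j) = y := by
  obtain ⟨ω, rfl⟩ := topTmul_surjective k A hij y
  obtain ⟨w, hwj, hw⟩ := exists_totalCycle_apply_eq (i := i)
    (C := fun a p => DRForm n a (freeRes (DiffOp k A) N p)) (d := fun a p => dRham k A _ a)
    (δ := resolutionD k A n N j) dRham_resolutionD
    (fun a p x => LinearMap.mem_ker.mp ((range_compLeft_signedD_succ j p _).le ⟨x, rfl⟩)) j
    (fun a p ha => (dRhamBoundaries_finsupp (hij ▸ ha)).ge) (Pi.single j ω) (by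
      rintro p rfl
      rw [Pi.single_eq_same]
      exact (ker_torD_topTmul hij (p + 1) p).le hy)
  rw [Pi.single_eq_same] at hwj
  refine ⟨w, fun p => ?_, congrArg (topTmul k A _ hij) hwj⟩
  rcases lt_or_ge p j with hp | hp
  · exact hw p hp
  · exact (subsingleton_DRForm (by omega)).elim _ _

variable (k A N) in
/-- The map from total cycles to Tor given by the augmentation `Ω^•(F_•) → A^τ ⊗_𝒟 F_•`. -/
def totalCyclesToTor (hij : i + j = n) :
    totalCycles k A N i j →ₗ[k] TorSpace k (DiffOp k A) (Transpose k A A) N j :=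
  SubQuot.ofMemCycles (LinearMap.range (torD k (DiffOp k A) (Transpose k A A) N j))
    (topTmul k A _ hij ∘ₗ totalCycles.component k A N i j j)
    fun w => (mem_totalCycles.mp w.2).topTmul_mem_torCycles hij

theorem totalCyclesToTor_surjective (hij : i + j = n) :
    Function.Surjective (totalCyclesToTor k A N hij) :=
  SubQuot.ofMemCycles_surjective fun _ hy => by
    obtain ⟨w, hw, h⟩ := exists_isTotalCycle_topTmul_eq hij hy
    exact ⟨⟨w, hw⟩, h⟩

theorem mem_ker_totalCyclesToTor_iff (hij : i + j = n) {w : totalCycles k A N i j} :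
    w ∈ LinearMap.ker (totalCyclesToTor k A N hij) ↔
      w.1 j ∈ LinearMap.range (resolutionD k A n N j (i + j) j) ⊔ dRhamBoundaries k A _ (i + j) :=
  SubQuot.mem_ker_ofMemCycles_iff.trans (topTmul_mem_range_torD_iff hij j j)

variable [Module k N] [IsScalarTower k (DiffOp k A) N]

theorem ker_totalCyclesToHdR (hij : i + j = n) :
    LinearMap.ker (totalCyclesToHdR k A N i j) = LinearMap.ker (totalCyclesToTor k A N hij) :=
  Submodule.ext fun w => mem_ker_totalCyclesToHdR_iff.trans <|
    ((mem_totalCycles.mp w.2).mem_zero_iff_mem hij.le).trans (mem_ker_totalCyclesToTor_iff hij).symm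

theorem isComparison_iff (hij : i + j = n)
    {e : HdR k A N i → TorSpace k (DiffOp k A) (Transpose k A A) N j} :
    IsComparison hij e ↔ ∀ c y, e c = y ↔
      ∃ w, totalCyclesToHdR k A N i j w = c ∧ totalCyclesToTor k A N hij w = y := by
  refine forall₂_congr fun c y => iff_congr Iff.rfl ⟨?_, ?_⟩
  · rintro ⟨w, hw, hc, hy⟩
    exact ⟨⟨w, hw⟩, SubQuot.ofMemCycles_eq_iff.mpr hc, SubQuot.ofMemCycles_eq_iff.mpr hy⟩
  · rintro ⟨w, hc, hy⟩
    exact ⟨w.1, w.2, SubQuot.ofMemCycles_eq_iff.mp hc, SubQuot.ofMemCycles_eq_iff.mp hy⟩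

theorem exists_isComparison (hij : i + j = n) :
    ∃ e : HdR k A N i ≃ₗ[k] TorSpace k (DiffOp k A) (Transpose k A A) N j,
      IsComparison hij e := by
  obtain ⟨e, he⟩ := exists_linearEquiv_of_surjective_of_ker_eq (Z := totalCycles k A N i j)
    totalCyclesToHdR_surjective (totalCyclesToTor_surjective hij) (ker_totalCyclesToHdR hij)
  exact ⟨e, (isComparison_iff hij).mpr he⟩

end Comparison

section Naturality

variable {k : Type u} [Field k] {n i j : ℕ}

theorem IsTotalCycle.map_freeResMap {A A' : Type*} [CommRing A] [Algebra k A] [CommRing A']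
    [Algebra k A'] [Coordinates k A n] [Coordinates k A' n] {N N' : Type*} [AddCommGroup N]
    [Module (DiffOp k A) N] [AddCommGroup N'] [Module (DiffOp k A') N']
    {f : DiffOp k A →+* DiffOp k A'} (hf : ∀ s, f (dd k A s) = dd k A' s) (φ : N →ₛₗ[f] N')
    {w : ∀ p, DRForm n (i + p) (freeRes (DiffOp k A) N p)} (hw : IsTotalCycle k A N i j w) :
    IsTotalCycle k A' N' i j fun p t => freeResMap f φ p (w p t) := by
  intro p
  have hdd (s : Fin n) (v : freeRes (DiffOp k A) N p) :
      freeResMap f φ p (dd k A s • v) = dd k A' s • freeResMap f φ p v := by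
    rw [map_smulₛₗ, hf]
  rw [dRham_map_coeff (freeResMap f φ p) hdd, hw p]
  funext t
  rw [map_zsmul, freeResMap_d]

variable [CharZero k] {M : Type v} [AddCommGroup M] [Module k M] [Module (PolyR k n) M]
  [Module (DiffOp k (PolyR k n)) M] [IsScalarTower k (DiffOp k (PolyR k n)) M]
  [IsScalarTower (PolyR k n) (DiffOp k (PolyR k n)) M]

theorem IsComparison.naturality (hij : i + j = n)
    {e : HdR k (PolyR k n) M i →
      TorSpace k (DiffOp k (PolyR k n)) (Transpose k (PolyR k n) (PolyR k n)) M j}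
    {e' : HdR k (PowR k n) (Completion k n M) i →
      TorSpace k (DiffOp k (PowR k n)) (Transpose k (PowR k n) (PowR k n)) (Completion k n M) j}
    (he : IsComparison hij e) (he' : IsComparison hij e') (c : HdR k (PolyR k n) M i) :
    e' (kappaCoh k n M i c) = iota k n M j (e c) := by
  obtain ⟨w, hw, ⟨z, hz, hzc⟩, y, hy, hyc⟩ := (he c (e c)).mp rfl
  have hdd (s : Fin n) : extendOp k n (dd k (PolyR k n) s) = dd k (PowR k n) s :=
    DiffOp.lift_dd _ _ _ _ s
  have hone : transposeIncl k n (Transpose.of k (PolyR k n) 1) = Transpose.of k (PowR k n) 1 :=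
    map_one (polyToPow k n)
  rw [← hyc, ← hzc]
  refine (he' _ _).mpr ⟨_, hw.map_freeResMap hdd (kappaSemilinear k n M), ⟨_, ?_, rfl⟩,
    _, ?_, rfl⟩
  · change kappaForm k n M i z.1 = _
    rw [hz]
    funext s
    exact (freeResMap_aug (extendOp k n).toRingHom (kappaSemilinear k n M) (w 0 s)).symm
  · change torChainMap (extendOp k n) (transposeIncl k n) (transposeIncl_smul k n)
      (kappaSemilinear k n M) j y.1 = _
    rw [hy, ← hone]
    rfl

end Naturality

end

theorem mainTheorem5 (k : Type*) [Field k] [CharZero k] (n : ℕ)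
    (M : Type*) [AddCommGroup M] [Module k M] [Module (PolyR k n) M]
    [Module (DiffOp k (PolyR k n)) M] [IsScalarTower k (DiffOp k (PolyR k n)) M]
    [IsScalarTower (PolyR k n) (DiffOp k (PolyR k n)) M] (i : ℕ) :
    (∀ (j : ℕ) (hij : i + j = n),
      ∃ (e : HdR k (PolyR k n) M i ≃ₗ[k]
            TorSpace k (DiffOp k (PolyR k n)) (Transpose k (PolyR k n) (PolyR k n)) M j)
        (e' : HdR k (PowR k n) (Completion k n M) i ≃ₗ[k]
            TorSpace k (DiffOp k (PowR k n)) (Transpose k (PowR k n) (PowR k n))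
              (Completion k n M) j),
        IsComparison hij e ∧ IsComparison hij e' ∧
          e'.toLinearMap ∘ₗ kappaCoh k n M i = iota k n M j ∘ₗ e.toLinearMap) ∧
    (n < i → Subsingleton (HdR k (PolyR k n) M i) ∧
      Subsingleton (HdR k (PowR k n) (Completion k n M) i)) := by
  refine ⟨fun j hij => ?_, fun hi => ⟨subsingleton_HdR hi, subsingleton_HdR hi⟩⟩
  obtain ⟨e, he⟩ := exists_isComparison (k := k) (A := PolyR k n) (N := M) hij
  obtain ⟨e', he'⟩ := exists_isComparison (k := k) (A := PowR k n) (N := Completion k n M) hij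
  exact ⟨e, e', he, he', LinearMap.ext fun c => he.naturality hij he' c⟩
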